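/- Let $N\ge 1$ be an integer, let $R>0$, $a\ge 0$, $b\ge 0$, $p>0$ and $s\ge 1$ be real numbers, and let $B_R=\{x\in\mathbb R^N:|x|<R\}$. Consider the system $$\Delta u=|x|^a v^p,\qquad \Delta v=|x|^b|\nabla u|^s\qquad\text{in } B_R .$$ (When $a=0$ or $b=0$, the corresponding weight is identically $1$.) A positive radial solution is a pair of radially symmetric functions $u,v\in C^2(B_R)$ with $u>0$ and $v>0$ in $B_R$ that satisfies both equations at every point of $B_R$. Then: (i) Every positive radial solution $(u,v)$ has both $u$ and $v$ bounded in $B_R$ if and only if $ps\le 1$. (ii) There exists a positive radial solution $(u,v)$ with $u$ bounded in $B_R$ and $\lim_{|x|\to R^-}v(x)=\infty$ if and only if $s>2\left(1+\frac1p\right)$. (iii) There exists a positive radial solution $(u,v)$ with $\lim_{|x|\to R^-}u(x)=\lim_{|x|\to R^-}v(x)=\infty$ if and only if $\frac1p<s\le 2\left(1+\frac1p\right)$. The same condition is also necessary and sufficient for the existence of a positive radial solution $(u,v)$ with $\lim_{|x|\to R^-}u(x)=\infty$. -/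

import Mathlib

open Filter Topology Metric
open scoped Laplacian Gradient

/-- `u` is radially symmetric on the open ball of radius `R` centred at the origin. -/
def IsRadialOnBall {N : ℕ} (R : ℝ) (u : EuclideanSpace ℝ (Fin N) → ℝ) : Prop :=
  ∀ x ∈ ball (0 : EuclideanSpace ℝ (Fin N)) R, ∀ y ∈ ball (0 : EuclideanSpace ℝ (Fin N)) R,
    ‖x‖ = ‖y‖ → u x = u y

/-- `(u, v)` is a positive radial classical (`C²`) solution of
`Δu = |x|^a v^p`, `Δv = |x|^b |∇u|^s` in the open ball of radius `R` centred at the origin.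
Only the values of `u` and `v` on the ball matter. -/
structure IsPositiveRadialSolution {N : ℕ} (R a b p s : ℝ)
    (u v : EuclideanSpace ℝ (Fin N) → ℝ) : Prop where
  contDiffOn_fst : ContDiffOn ℝ 2 u (ball 0 R)
  contDiffOn_snd : ContDiffOn ℝ 2 v (ball 0 R)
  radial_fst : IsRadialOnBall R u
  radial_snd : IsRadialOnBall R v
  pos_fst : ∀ x ∈ ball (0 : EuclideanSpace ℝ (Fin N)) R, 0 < u x
  pos_snd : ∀ x ∈ ball (0 : EuclideanSpace ℝ (Fin N)) R, 0 < v x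
  eq_fst : ∀ x ∈ ball (0 : EuclideanSpace ℝ (Fin N)) R, Δ u x = ‖x‖ ^ a * v x ^ p
  eq_snd : ∀ x ∈ ball (0 : EuclideanSpace ℝ (Fin N)) R, Δ v x = ‖x‖ ^ b * ‖∇ u x‖ ^ s

/-- `u` is bounded in the open ball of radius `R` centred at the origin. -/
def IsBoundedOnBall {N : ℕ} (R : ℝ) (u : EuclideanSpace ℝ (Fin N) → ℝ) : Prop :=
  ∃ M : ℝ, ∀ x ∈ ball (0 : EuclideanSpace ℝ (Fin N)) R, |u x| ≤ M

/-- `u x → ∞` as `|x| → R` from inside the ball of radius `R`. -/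
def BlowsUpAtBoundary {N : ℕ} (R : ℝ) (u : EuclideanSpace ℝ (Fin N) → ℝ) : Prop :=
  Tendsto u (comap (fun x : EuclideanSpace ℝ (Fin N) => ‖x‖) (𝓝[<] R)) atTop

/-! Put `d = N - 1`, `w = u'` and `z = v'`. The system becomes `w' + (d/r) w = r^a v^p`, `z' + (d/r)
z = r^b w^s`, with `w` and `z` zero at the origin. The right-hand sides without their weights are
nondecreasing, so the friction terms absorb only a fixed fraction of them
(`RadialODE.le_deriv_of_monotoneOn`). Away from the origin, and up to constants, `w' ~ v^p` and `z'
~ w^s`.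

If `p s ≤ 1`, then `v' = z ≲ w^s ≲ v^(p s) ≤ 1 + v`, and Gronwall bounds everything.

In general, integrating products of the equations gives the comparison `v^(2p+1) ~ w^(s+2)`, up to
constants, on `[r₀, R)`: one side is `mul_w_rpow_le` with `mul_w_rpow_le_snd`, the other
`exists_snd_rpow_le`. Hence `w' ~ w^q` with `q = p (s + 2) / (2 p + 1)`. Here `q > 1` iff `p s > 1`,
and `q > 2` iff `s > 2 (1 + 1/p)`. Superlinearity rules out global profiles (`not_forall_profile`).
For `q > 2` the integral of `w` converges at blow-up, so `u` stays bounded (`bounded_fst`). For `q ≤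
2` one has `(log w)' ≲ w = u'`, so a bounded `u` would bound `w` and then `v` (`tendsto_fst_atTop`).

For existence, the least fixed point of a monotone integral operator on `[0, ∞]`-valued functions is
taken up to the first radius where it is infinite. It must blow up there, since a bounded solution
extends, and scaling moves that radius to any `R`. The same profile serves every case with `p s >
1`: the size of `s` alone decides whether `u` blows up. `RadialODE.contDiffOn_comp_norm` and
`exists_radial_deriv` translate between profiles and classical solutions on the ball. -/

/-! ### The radial ODE: positivity, monotonicity and friction estimates. -/

section RadialAnalysis

open Set

theorem monotoneOn_Ico_of_hasDerivAt {α β : ℝ} {f f' : ℝ → ℝ} (hc : ContinuousOn f (Ico α β))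
    (hd : ∀ r ∈ Ioo α β, HasDerivAt f (f' r) r) (h0 : ∀ r ∈ Ioo α β, 0 ≤ f' r) :
    MonotoneOn f (Ico α β) := by
  refine monotoneOn_of_hasDerivWithinAt_nonneg (f' := f') (convex_Ico α β) hc ?_ ?_ <;>
    rw [interior_Ico]
  · exact fun r hr => (hd r hr).hasDerivWithinAt
  · exact h0

theorem antitoneOn_Ico_of_hasDerivAt {α β : ℝ} {f f' : ℝ → ℝ} (hc : ContinuousOn f (Ico α β))
    (hd : ∀ r ∈ Ioo α β, HasDerivAt f (f' r) r) (h0 : ∀ r ∈ Ioo α β, f' r ≤ 0) :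
    AntitoneOn f (Ico α β) := by
  refine antitoneOn_of_hasDerivWithinAt_nonpos (f' := f') (convex_Ico α β) hc ?_ ?_ <;>
    rw [interior_Ico]
  · exact fun r hr => (hd r hr).hasDerivWithinAt
  · exact h0

theorem strictMonoOn_Ico_of_hasDerivAt {α β : ℝ} {f f' : ℝ → ℝ} (hc : ContinuousOn f (Ico α β))
    (hd : ∀ r ∈ Ioo α β, HasDerivAt f (f' r) r) (h0 : ∀ r ∈ Ioo α β, 0 < f' r) :
    StrictMonoOn f (Ico α β) := by
  refine strictMonoOn_of_hasDerivWithinAt_pos (f' := f') (convex_Ico α β) hc ?_ ?_ <;>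
    rw [interior_Ico]
  · exact fun r hr => (hd r hr).hasDerivWithinAt
  · exact h0

/-- A function whose derivative is at most `K` grows at most linearly with slope `K`. -/
theorem le_add_mul_of_hasDerivAt_le {R K : ℝ} {f f' : ℝ → ℝ} (hc : ContinuousOn f (Ico 0 R))
    (hd : ∀ r ∈ Ioo 0 R, HasDerivAt f (f' r) r) (hK : ∀ r ∈ Ioo 0 R, f' r ≤ K) :
    ∀ r ∈ Ico 0 R, f r ≤ f 0 + K * r := by
  intro r hr
  have hm : AntitoneOn (fun r => f r - K * r) (Ico 0 R) := by
    refine antitoneOn_Ico_of_hasDerivAt (f' := fun r => f' r - K * 1) (by fun_prop) ?_ ?_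
    · exact fun t ht => (hd t ht).sub ((hasDerivAt_id t).const_mul K)
    · intro t ht
      have := hK t ht
      linarith
  have := hm ⟨le_rfl, hr.1.trans_lt hr.2⟩ hr hr.1
  simp only at this
  linarith

/-- `f` solves `f' + (d / r) f = h` on `(0, R)` and is continuous on `[0, R)` with `f 0 = 0`. -/
structure RadialODE (d R : ℝ) (f h : ℝ → ℝ) : Prop where
  cont : ContinuousOn f (Ico 0 R)
  zero : f 0 = 0
  hasDerivAt : ∀ r ∈ Ioo 0 R, HasDerivAt f (h r - d / r * f r) r

namespace RadialODE

variable {d R a : ℝ} {f h g : ℝ → ℝ}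

/-- The integrating factor `r ^ d` removes the singular friction term. -/
theorem hasDerivAt_rpow_mul (H : RadialODE d R f h) {r : ℝ} (hr : r ∈ Ioo 0 R) :
    HasDerivAt (fun r => r ^ d * f r) (r ^ d * h r) r := by
  have h1 := (Real.hasDerivAt_rpow_const (p := d) (Or.inl hr.1.ne')).fun_mul (H.hasDerivAt r hr)
  refine h1.congr_deriv ?_
  rw [Real.rpow_sub_one hr.1.ne']
  field_simp [hr.1.ne']
  ring

theorem continuousOn_rpow_mul (hd : 0 ≤ d) (H : RadialODE d R f h) :
    ContinuousOn (fun r => r ^ d * f r) (Ico 0 R) :=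
  (Real.continuous_rpow_const hd).continuousOn.mul H.cont

theorem pos (hd : 0 ≤ d) (H : RadialODE d R f h) (hh : ∀ r ∈ Ioo 0 R, 0 < h r) :
    ∀ r ∈ Ioo 0 R, 0 < f r := by
  intro r hr
  have hm := strictMonoOn_Ico_of_hasDerivAt (H.continuousOn_rpow_mul hd)
    (fun r hr => H.hasDerivAt_rpow_mul hr)
    (fun r hr => mul_pos (Real.rpow_pos_of_pos hr.1 d) (hh r hr))
  have := hm ⟨le_rfl, hr.1.trans hr.2⟩ ⟨hr.1.le, hr.2⟩ hr.1
  simp only [H.zero, mul_zero] at this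
  exact pos_of_mul_pos_right this (Real.rpow_nonneg hr.1.le d)

/-- Formally `r^d f(r) = ∫₀ʳ t^(d+a) g(t) dt`, and monotonicity allows `g t` to be replaced by the
endpoint value `g r`. The proof differentiates the difference of the two sides with `g r` frozen. -/
theorem le_of_monotoneOn (hd : 0 ≤ d) (ha : 0 ≤ a)
    (H : RadialODE d R f (fun r => r ^ a * g r)) (hg : MonotoneOn g (Ioo 0 R)) :
    ∀ r ∈ Ioo 0 R, (d + a + 1) * f r ≤ r ^ (a + 1) * g r := by
  intro r hr
  have hda : 0 < d + a + 1 := by linarith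
  have hm : AntitoneOn (fun t => (d + a + 1) * (t ^ d * f t) - t ^ (d + a + 1) * g r)
      (Icc 0 r) := by
    refine antitoneOn_of_hasDerivWithinAt_nonpos
      (f' := fun t => (d + a + 1) * (t ^ d * (t ^ a * g t)) - (d + a + 1) * t ^ (d + a) * g r)
      (convex_Icc 0 r) ?_ ?_ ?_
    · refine ContinuousOn.sub (continuousOn_const.mul ((H.continuousOn_rpow_mul hd).mono ?_))
        ((Real.continuous_rpow_const hda.le).continuousOn.mul continuousOn_const)
      exact fun t ht => ⟨ht.1, ht.2.trans_lt hr.2⟩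
    · rw [interior_Icc]
      intro t ht
      have h1 := (H.hasDerivAt_rpow_mul ⟨ht.1, ht.2.trans hr.2⟩).const_mul (d + a + 1)
      have h2 := (Real.hasDerivAt_rpow_const (p := d + a + 1) (Or.inl ht.1.ne')).mul_const (g r)
      rw [add_sub_cancel_right] at h2
      exact (h1.sub h2).hasDerivWithinAt
    · rw [interior_Icc]
      intro t ht
      have h1 : g t ≤ g r := hg ⟨ht.1, ht.2.trans hr.2⟩ hr ht.2.le
      have h2 : 0 < t ^ (d + a) := Real.rpow_pos_of_pos ht.1 _
      have h3 : t ^ d * (t ^ a * g t) = t ^ (d + a) * g t := by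
        rw [Real.rpow_add ht.1]; ring
      simp only [h3]
      have h4 := mul_le_mul_of_nonneg_left h1 (mul_pos hda h2).le
      linarith
  have := hm ⟨le_rfl, hr.1.le⟩ ⟨hr.1.le, le_rfl⟩ hr.1.le
  simp only [H.zero, mul_zero, Real.zero_rpow hda.ne', zero_mul, sub_zero] at this
  rw [show d + a + 1 = d + (a + 1) by ring, Real.rpow_add hr.1] at this
  have hp := Real.rpow_pos_of_pos hr.1 d
  have h5 : r ^ d * ((d + a + 1) * f r) ≤ r ^ d * (r ^ (a + 1) * g r) := by
    rw [show d + a + 1 = d + (a + 1) by ring]; linarith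
  exact le_of_mul_le_mul_left h5 hp

/-- By the previous bound, friction takes at most the fraction `d / (d + a + 1)` of the source. This
is what makes `f'` comparable to `r ^ a * g`. -/
theorem le_deriv_of_monotoneOn (hd : 0 ≤ d) (ha : 0 ≤ a)
    (H : RadialODE d R f (fun r => r ^ a * g r)) (hg : MonotoneOn g (Ioo 0 R)) :
    ∀ r ∈ Ioo 0 R, (a + 1) / (d + a + 1) * (r ^ a * g r) ≤ r ^ a * g r - d / r * f r := by
  intro r hr
  have hda : 0 < d + a + 1 := by linarith
  have h1 := H.le_of_monotoneOn hd ha hg r hr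
  rw [Real.rpow_add_one hr.1.ne'] at h1
  have h2 : d / r * f r ≤ d / (d + a + 1) * (r ^ a * g r) := by
    rw [div_mul_eq_mul_div, div_mul_eq_mul_div, div_le_div_iff₀ hr.1 hda]
    nlinarith [mul_le_mul_of_nonneg_left h1 hd]
  have h3 : (a + 1) / (d + a + 1) * (r ^ a * g r)
      = r ^ a * g r - d / (d + a + 1) * (r ^ a * g r) := by
    field_simp
    ring
  linarith

end RadialODE

/-- The radial form of the system: `w = u'`, `z = v'` and `d = N - 1`. -/
structure RadialProfile (d a b p s R : ℝ) (u v w z : ℝ → ℝ) : Prop where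
  cont_fst : ContinuousOn u (Ico 0 R)
  cont_snd : ContinuousOn v (Ico 0 R)
  pos_fst : ∀ r ∈ Ico 0 R, 0 < u r
  pos_snd : ∀ r ∈ Ico 0 R, 0 < v r
  hasDerivAt_fst : ∀ r ∈ Ioo 0 R, HasDerivAt u (w r) r
  hasDerivAt_snd : ∀ r ∈ Ioo 0 R, HasDerivAt v (z r) r
  ode_fst : RadialODE d R w (fun r => r ^ a * v r ^ p)
  ode_snd : RadialODE d R z (fun r => r ^ b * |w r| ^ s)

namespace RadialProfile

variable {d a b p s R : ℝ} {u v w z : ℝ → ℝ}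

theorem w_pos (hd : 0 ≤ d) (H : RadialProfile d a b p s R u v w z) :
    ∀ r ∈ Ioo 0 R, 0 < w r :=
  H.ode_fst.pos hd fun r hr => mul_pos (Real.rpow_pos_of_pos hr.1 _)
    (Real.rpow_pos_of_pos (H.pos_snd r ⟨hr.1.le, hr.2⟩) _)

theorem z_pos (hd : 0 ≤ d) (H : RadialProfile d a b p s R u v w z) :
    ∀ r ∈ Ioo 0 R, 0 < z r :=
  H.ode_snd.pos hd fun r hr => mul_pos (Real.rpow_pos_of_pos hr.1 _)
    (Real.rpow_pos_of_pos (abs_pos.2 (H.w_pos hd r hr).ne') _)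

theorem monotoneOn_fst (hd : 0 ≤ d) (H : RadialProfile d a b p s R u v w z) :
    MonotoneOn u (Ico 0 R) :=
  monotoneOn_Ico_of_hasDerivAt H.cont_fst H.hasDerivAt_fst
    fun r hr => (H.w_pos hd r hr).le

theorem monotoneOn_snd (hd : 0 ≤ d) (H : RadialProfile d a b p s R u v w z) :
    MonotoneOn v (Ico 0 R) :=
  monotoneOn_Ico_of_hasDerivAt H.cont_snd H.hasDerivAt_snd
    fun r hr => (H.z_pos hd r hr).le

theorem monotoneOn_snd_rpow (hd : 0 ≤ d) (hp : 0 ≤ p) (H : RadialProfile d a b p s R u v w z) :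
    MonotoneOn (fun r => v r ^ p) (Ioo 0 R) := fun x hx _ hy hxy =>
  Real.rpow_le_rpow (H.pos_snd x ⟨hx.1.le, hx.2⟩).le
    (H.monotoneOn_snd hd ⟨hx.1.le, hx.2⟩ ⟨hy.1.le, hy.2⟩ hxy) hp

theorem le_w_deriv (hd : 0 ≤ d) (ha : 0 ≤ a) (hp : 0 ≤ p)
    (H : RadialProfile d a b p s R u v w z) : ∀ r ∈ Ioo 0 R,
    (a + 1) / (d + a + 1) * (r ^ a * v r ^ p) ≤ r ^ a * v r ^ p - d / r * w r :=
  H.ode_fst.le_deriv_of_monotoneOn hd ha (H.monotoneOn_snd_rpow hd hp)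

theorem w_deriv_le (hd : 0 ≤ d) (H : RadialProfile d a b p s R u v w z) : ∀ r ∈ Ioo 0 R,
    r ^ a * v r ^ p - d / r * w r ≤ r ^ a * v r ^ p := fun r hr =>
  sub_le_self _ (mul_nonneg (div_nonneg hd hr.1.le) (H.w_pos hd r hr).le)

theorem w_deriv_nonneg (hd : 0 ≤ d) (ha : 0 ≤ a) (hp : 0 ≤ p)
    (H : RadialProfile d a b p s R u v w z) : ∀ r ∈ Ioo 0 R,
    0 ≤ r ^ a * v r ^ p - d / r * w r := fun r hr =>
  (mul_nonneg (by positivity) (mul_nonneg (Real.rpow_nonneg hr.1.le _)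
    (Real.rpow_nonneg (H.pos_snd r ⟨hr.1.le, hr.2⟩).le _))).trans (H.le_w_deriv hd ha hp r hr)

theorem monotoneOn_w (hd : 0 ≤ d) (ha : 0 ≤ a) (hp : 0 ≤ p)
    (H : RadialProfile d a b p s R u v w z) : MonotoneOn w (Ico 0 R) :=
  monotoneOn_Ico_of_hasDerivAt H.ode_fst.cont H.ode_fst.hasDerivAt (H.w_deriv_nonneg hd ha hp)

theorem monotoneOn_w_rpow (hd : 0 ≤ d) (ha : 0 ≤ a) (hp : 0 ≤ p) (hs : 0 ≤ s)
    (H : RadialProfile d a b p s R u v w z) : MonotoneOn (fun r => |w r| ^ s) (Ioo 0 R) := by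
  intro x hx y hy hxy
  simp only [abs_of_pos (H.w_pos hd x hx), abs_of_pos (H.w_pos hd y hy)]
  exact Real.rpow_le_rpow (H.w_pos hd x hx).le
    (H.monotoneOn_w hd ha hp ⟨hx.1.le, hx.2⟩ ⟨hy.1.le, hy.2⟩ hxy) hs

theorem z_hasDerivAt (hd : 0 ≤ d) (H : RadialProfile d a b p s R u v w z) : ∀ r ∈ Ioo 0 R,
    HasDerivAt z (r ^ b * w r ^ s - d / r * z r) r := fun r hr => by
  simpa only [abs_of_pos (H.w_pos hd r hr)] using H.ode_snd.hasDerivAt r hr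

theorem le_z_deriv (hd : 0 ≤ d) (ha : 0 ≤ a) (hb : 0 ≤ b) (hp : 0 ≤ p) (hs : 0 ≤ s)
    (H : RadialProfile d a b p s R u v w z) : ∀ r ∈ Ioo 0 R,
    (b + 1) / (d + b + 1) * (r ^ b * w r ^ s) ≤ r ^ b * w r ^ s - d / r * z r := fun r hr => by
  simpa only [abs_of_pos (H.w_pos hd r hr)] using
    H.ode_snd.le_deriv_of_monotoneOn hd hb (H.monotoneOn_w_rpow hd ha hp hs) r hr

theorem z_deriv_le (hd : 0 ≤ d) (H : RadialProfile d a b p s R u v w z) : ∀ r ∈ Ioo 0 R,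
    r ^ b * w r ^ s - d / r * z r ≤ r ^ b * w r ^ s := fun r hr =>
  sub_le_self _ (mul_nonneg (div_nonneg hd hr.1.le) (H.z_pos hd r hr).le)

/-- `w ≤ C v ^ p` on bounded intervals. -/
theorem w_le (hd : 0 ≤ d) (ha : 0 ≤ a) (hp : 0 ≤ p)
    (H : RadialProfile d a b p s R u v w z) : ∀ r ∈ Ioo 0 R,
    w r ≤ R ^ (a + 1) * v r ^ p := fun r hr => by
  have h1 := H.ode_fst.le_of_monotoneOn hd ha (H.monotoneOn_snd_rpow hd hp) r hr
  have h2 : r ^ (a + 1) ≤ R ^ (a + 1) := Real.rpow_le_rpow hr.1.le hr.2.le (by linarith)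
  have h3 := mul_le_mul_of_nonneg_right h2 (Real.rpow_nonneg (H.pos_snd r ⟨hr.1.le, hr.2⟩).le p)
  have h4 := mul_nonneg (add_nonneg hd ha) (H.w_pos hd r hr).le
  linarith

/-- `z ≤ C w ^ s` on bounded intervals. -/
theorem z_le (hd : 0 ≤ d) (ha : 0 ≤ a) (hb : 0 ≤ b) (hp : 0 ≤ p) (hs : 0 ≤ s)
    (H : RadialProfile d a b p s R u v w z) : ∀ r ∈ Ioo 0 R,
    z r ≤ R ^ (b + 1) * w r ^ s := fun r hr => by
  have h1 := H.ode_snd.le_of_monotoneOn hd hb (H.monotoneOn_w_rpow hd ha hp hs) r hr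
  rw [abs_of_pos (H.w_pos hd r hr)] at h1
  have h2 : r ^ (b + 1) ≤ R ^ (b + 1) := Real.rpow_le_rpow hr.1.le hr.2.le (by linarith)
  have h3 := mul_le_mul_of_nonneg_right h2 (Real.rpow_nonneg (H.w_pos hd r hr).le s)
  have h4 := mul_nonneg (add_nonneg hd hb) (H.z_pos hd r hr).le
  linarith

theorem bounded_fst_of_bounded_w {M : ℝ} (H : RadialProfile d a b p s R u v w z)
    (hM : ∀ r ∈ Ioo 0 R, w r ≤ M) (hM0 : 0 ≤ M) :
    ∀ r ∈ Ico 0 R, u r ≤ u 0 + M * R := fun r hr =>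
  (le_add_mul_of_hasDerivAt_le H.cont_fst H.hasDerivAt_fst hM r hr).trans
    (by gcongr; exact hr.2.le)

theorem bounded_snd_of_bounded_w {M : ℝ} (hR : 0 ≤ R) (hd : 0 ≤ d) (ha : 0 ≤ a) (hb : 0 ≤ b)
    (hp : 0 ≤ p) (hs : 0 ≤ s) (H : RadialProfile d a b p s R u v w z)
    (hM : ∀ r ∈ Ioo 0 R, w r ≤ M) (hM0 : 0 ≤ M) :
    ∀ r ∈ Ico 0 R, v r ≤ v 0 + R ^ (b + 1) * M ^ s * R := fun r hr =>
  (le_add_mul_of_hasDerivAt_le H.cont_snd H.hasDerivAt_snd (K := R ^ (b + 1) * M ^ s)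
    (fun t ht => (H.z_le hd ha hb hp hs t ht).trans (mul_le_mul_of_nonneg_left
      (Real.rpow_le_rpow (H.w_pos hd t ht).le (hM t ht) hs) (Real.rpow_nonneg hR _))) r hr).trans
    (by gcongr; exact hr.2.le)

/-- If `p s ≤ 1`, both components are bounded. -/
theorem bounded_of_mul_le_one (hR : 0 < R) (hd : 0 ≤ d) (ha : 0 ≤ a) (hb : 0 ≤ b)
    (hp : 0 ≤ p) (hs : 0 ≤ s) (hps : p * s ≤ 1) (H : RadialProfile d a b p s R u v w z) :
    ∃ M, ∀ r ∈ Ico 0 R, u r ≤ M ∧ v r ≤ M := by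
  set K := R ^ (b + 1) * (R ^ (a + 1)) ^ s with hK
  have hK0 : 0 ≤ K := by positivity
  -- Chaining `z ≲ w^s`, `w ≲ v^p` and `p s ≤ 1` gives a linear differential inequality for `1 + v`,
  -- to which Gronwall applies.
  have hz : ∀ r ∈ Ioo 0 R, z r ≤ K * (1 + v r) := by
    intro r hr
    have hv := H.pos_snd r ⟨hr.1.le, hr.2⟩
    have h1 : w r ^ s ≤ (R ^ (a + 1)) ^ s * (v r ^ (p * s)) := by
      rw [Real.rpow_mul hv.le, ← Real.mul_rpow (by positivity) (by positivity)]
      exact Real.rpow_le_rpow (H.w_pos hd r hr).le (H.w_le hd ha hp r hr) hs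
    have h2 : v r ^ (p * s) ≤ 1 + v r := by
      rcases le_total (v r) 1 with h | h
      · exact (Real.rpow_le_one hv.le h (by positivity)).trans (by linarith)
      · exact (Real.rpow_le_rpow_of_exponent_le h hps).trans (by rw [Real.rpow_one]; linarith)
    calc z r ≤ R ^ (b + 1) * w r ^ s := H.z_le hd ha hb hp hs r hr
      _ ≤ R ^ (b + 1) * ((R ^ (a + 1)) ^ s * (v r ^ (p * s))) := by gcongr
      _ = K * (v r ^ (p * s)) := by rw [hK]; ring
      _ ≤ K * (1 + v r) := by gcongr
  have hm : AntitoneOn (fun r => (1 + v r) * Real.exp (-(K * r))) (Ico 0 R) := by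
    refine antitoneOn_Ico_of_hasDerivAt
      (f' := fun r => z r * Real.exp (-(K * r)) +
        (1 + v r) * (Real.exp (-(K * r)) * (-(K * 1)))) ?_ ?_ ?_
    · exact (continuousOn_const.add H.cont_snd).mul (by fun_prop)
    · intro r hr
      exact ((H.hasDerivAt_snd r hr).const_add 1).mul
        (((hasDerivAt_id r).const_mul K).neg.exp)
    · intro r hr
      have h1 := hz r hr
      have h2 := Real.exp_pos (-(K * r))
      nlinarith
  have hvM : ∀ r ∈ Ico 0 R, v r ≤ (1 + v 0) * Real.exp (K * R) := by
    intro r hr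
    have h1 := hm ⟨le_rfl, hR⟩ hr hr.1
    simp only [mul_zero, neg_zero, Real.exp_zero, mul_one, Real.exp_neg] at h1
    rw [← div_eq_mul_inv, div_le_iff₀ (Real.exp_pos _)] at h1
    have h2 : Real.exp (K * r) ≤ Real.exp (K * R) :=
      Real.exp_le_exp.2 (mul_le_mul_of_nonneg_left hr.2.le hK0)
    have h3 := H.pos_snd 0 ⟨le_rfl, hR⟩
    have h4 := mul_le_mul_of_nonneg_left h2 (by linarith : 0 ≤ 1 + v 0)
    linarith
  set M := (1 + v 0) * Real.exp (K * R)
  have hM0 : 0 ≤ M := (H.pos_snd 0 ⟨le_rfl, hR⟩).le.trans (hvM 0 ⟨le_rfl, hR⟩)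
  have hw : ∀ r ∈ Ioo 0 R, w r ≤ R ^ (a + 1) * M ^ p := fun r hr =>
    (H.w_le hd ha hp r hr).trans (mul_le_mul_of_nonneg_left
      (Real.rpow_le_rpow (H.pos_snd r ⟨hr.1.le, hr.2⟩).le (hvM r ⟨hr.1.le, hr.2⟩) hp)
      (by positivity))
  refine ⟨max (u 0 + R ^ (a + 1) * M ^ p * R) M, fun r hr => ⟨?_, ?_⟩⟩
  · exact (H.bounded_fst_of_bounded_w hw (by positivity) r hr).trans (le_max_left _ _)
  · exact (hvM r hr).trans (le_max_right _ _)

end RadialProfile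

end RadialAnalysis

/-! ### Comparison of `v ^ (2p+1)` with `w ^ (s+2)`, and its consequences for blow-up. -/

section RadialBlowUpRates

open Set

namespace RadialProfile

variable {d a b p s R : ℝ} {u v w z : ℝ → ℝ}

/-- First integration: `(r^a v^p z)' ≥ r^a v^p z' ≳ r^a v^p w^s ≥ w' w^s`, and the last term is a
multiple of `(w^(s+1))'`. The hypothesis `hk` compares the derivatives and `hk0` the values at `r₀`.
-/
theorem mul_w_rpow_le {r₀ k : ℝ} (hd : 0 ≤ d) (ha : 0 ≤ a) (hb : 0 ≤ b) (hp : 0 < p)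
    (hs : 1 ≤ s) (hr₀ : 0 < r₀) (H : RadialProfile d a b p s R u v w z)
    (hk : k * (s + 1) ≤ (b + 1) / (d + b + 1) * r₀ ^ b)
    (hk0 : k * w r₀ ^ (s + 1) ≤ r₀ ^ a * v r₀ ^ p * z r₀) :
    ∀ r ∈ Ico r₀ R, k * w r ^ (s + 1) ≤ r ^ a * v r ^ p * z r := by
  intro r hr
  have hsub : Ico r₀ R ⊆ Ico 0 R := Ico_subset_Ico_left hr₀.le
  have hm : MonotoneOn (fun r => r ^ a * v r ^ p * z r - k * w r ^ (s + 1)) (Ico r₀ R) := by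
    refine monotoneOn_Ico_of_hasDerivAt
      (f' := fun r => ((a * r ^ (a - 1)) * v r ^ p + r ^ a * (z r * p * v r ^ (p - 1))) * z r
        + r ^ a * v r ^ p * (r ^ b * w r ^ s - d / r * z r)
        - k * ((r ^ a * v r ^ p - d / r * w r) * (s + 1) * w r ^ (s + 1 - 1))) ?_ ?_ ?_
    · refine ContinuousOn.sub (((Real.continuous_rpow_const ha).continuousOn.mul
        ((H.cont_snd.mono hsub).rpow_const fun _ _ => Or.inr hp.le)).mul
        (H.ode_snd.cont.mono hsub)) (continuousOn_const.mul
        ((H.ode_fst.cont.mono hsub).rpow_const fun _ _ => Or.inr (by linarith)))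
    · intro t ht
      have ht' : t ∈ Ioo 0 R := ⟨hr₀.trans ht.1, ht.2⟩
      exact (((Real.hasDerivAt_rpow_const (Or.inl ht'.1.ne')).fun_mul
        ((H.hasDerivAt_snd t ht').rpow_const
          (Or.inl (H.pos_snd t ⟨ht'.1.le, ht.2⟩).ne'))).fun_mul (H.z_hasDerivAt hd t ht')).fun_sub
        (((H.ode_fst.hasDerivAt t ht').rpow_const (Or.inr (by linarith))).const_mul k)
    · intro t ht
      have ht' : t ∈ Ioo 0 R := ⟨hr₀.trans ht.1, ht.2⟩
      have hv := H.pos_snd t ⟨ht'.1.le, ht.2⟩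
      have hw := H.w_pos hd t ht'
      have hz := H.z_pos hd t ht'
      have ht0 := ht'.1
      have h1 : 0 ≤ ((a * t ^ (a - 1)) * v t ^ p + t ^ a * (z t * p * v t ^ (p - 1))) * z t := by
        positivity
      have h2 := H.le_z_deriv hd ha hb hp.le (by linarith) t ht'
      have h3 := H.w_deriv_le hd t ht'
      have hX : 0 < t ^ a * v t ^ p := by positivity
      have hW : 0 < w t ^ s := by positivity
      have h5 : r₀ ^ b ≤ t ^ b := Real.rpow_le_rpow hr₀.le ht.1.le hb
      have hcb : 0 ≤ (b + 1) / (d + b + 1) := by positivity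
      rcases le_or_gt k 0 with hk1 | hk1
      · have h6 := H.w_deriv_nonneg hd ha hp.le t ht'
        have h7 : 0 ≤ t ^ a * v t ^ p * (t ^ b * w t ^ s - d / t * z t) :=
          mul_nonneg hX.le (le_trans (by positivity) h2)
        have h8 : k * ((t ^ a * v t ^ p - d / t * w t) * (s + 1) * w t ^ (s + 1 - 1)) ≤ 0 :=
          mul_nonpos_of_nonpos_of_nonneg hk1
            (mul_nonneg (mul_nonneg h6 (by linarith)) (by positivity))
        linarith
      · have h6 : k * ((t ^ a * v t ^ p - d / t * w t) * (s + 1) * w t ^ (s + 1 - 1))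
            ≤ k * ((t ^ a * v t ^ p) * (s + 1) * w t ^ s) := by
          rw [add_sub_cancel_right]
          have : 0 ≤ s + 1 := by linarith
          gcongr
        have h7 : t ^ a * v t ^ p * ((b + 1) / (d + b + 1) * (r₀ ^ b * w t ^ s))
            ≤ t ^ a * v t ^ p * (t ^ b * w t ^ s - d / t * z t) := by
          refine mul_le_mul_of_nonneg_left (le_trans ?_ h2) hX.le
          gcongr
        have h8 := mul_le_mul_of_nonneg_right hk (mul_pos hX hW).le
        linarith
  have h := hm ⟨le_rfl, hr.1.trans_lt hr.2⟩ hr hr.1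
  simp only at h
  linarith

/-- Second integration: multiplying the first estimate by `r^a v^p ≥ w'` gives `r^(2a) v^(2p) v' ≳
w' w^(s+1)`, and both sides are derivatives up to constants and a nonnegative term from the weight.
-/
theorem mul_w_rpow_le_snd {r₀ k l : ℝ} (hd : 0 ≤ d) (ha : 0 ≤ a) (hp : 0 < p)
    (hs : 1 ≤ s) (hr₀ : 0 < r₀) (H : RadialProfile d a b p s R u v w z) (hl : 0 ≤ l)
    (hk : ∀ r ∈ Ico r₀ R, k * w r ^ (s + 1) ≤ r ^ a * v r ^ p * z r)
    (hlk : l * (s + 2) ≤ (2 * p + 1) * k)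
    (hl0 : l * w r₀ ^ (s + 2) ≤ r₀ ^ (2 * a) * v r₀ ^ (2 * p + 1)) :
    ∀ r ∈ Ico r₀ R, l * w r ^ (s + 2) ≤ r ^ (2 * a) * v r ^ (2 * p + 1) := by
  intro r hr
  have hsub : Ico r₀ R ⊆ Ico 0 R := Ico_subset_Ico_left hr₀.le
  have hm : MonotoneOn (fun r => r ^ (2 * a) * v r ^ (2 * p + 1) - l * w r ^ (s + 2))
      (Ico r₀ R) := by
    refine monotoneOn_Ico_of_hasDerivAt
      (f' := fun r => (2 * a * r ^ (2 * a - 1)) * v r ^ (2 * p + 1)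
        + r ^ (2 * a) * (z r * (2 * p + 1) * v r ^ (2 * p + 1 - 1))
        - l * ((r ^ a * v r ^ p - d / r * w r) * (s + 2) * w r ^ (s + 2 - 1))) ?_ ?_ ?_
    · refine ContinuousOn.sub ((Real.continuous_rpow_const (by positivity)).continuousOn.mul
        ((H.cont_snd.mono hsub).rpow_const fun _ _ => Or.inr (by positivity)))
        (continuousOn_const.mul
        ((H.ode_fst.cont.mono hsub).rpow_const fun _ _ => Or.inr (by linarith)))
    · intro t ht
      have ht' : t ∈ Ioo 0 R := ⟨hr₀.trans ht.1, ht.2⟩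
      exact ((Real.hasDerivAt_rpow_const (Or.inl ht'.1.ne')).fun_mul
        ((H.hasDerivAt_snd t ht').rpow_const
          (Or.inl (H.pos_snd t ⟨ht'.1.le, ht.2⟩).ne'))).fun_sub
        (((H.ode_fst.hasDerivAt t ht').rpow_const (Or.inr (by linarith))).const_mul l)
    · intro t ht
      have ht' : t ∈ Ioo 0 R := ⟨hr₀.trans ht.1, ht.2⟩
      have hv := H.pos_snd t ⟨ht'.1.le, ht.2⟩
      have hw := H.w_pos hd t ht'
      have ht0 := ht'.1
      have h1 : 0 ≤ (2 * a * t ^ (2 * a - 1)) * v t ^ (2 * p + 1) := by positivity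
      have h3 := H.w_deriv_le hd t ht'
      have hX : 0 < t ^ a * v t ^ p := by positivity
      have e1 : t ^ (2 * a) = t ^ a * t ^ a := by rw [two_mul, Real.rpow_add ht0]
      have e2 : v t ^ (2 * p + 1 - 1) = v t ^ p * v t ^ p := by
        rw [add_sub_cancel_right, two_mul, Real.rpow_add hv]
      have e3 : s + 2 - 1 = s + 1 := by ring
      have h6 : l * ((t ^ a * v t ^ p - d / t * w t) * (s + 2) * w t ^ (s + 2 - 1))
            ≤ l * ((t ^ a * v t ^ p) * (s + 2) * w t ^ (s + 1)) := by
        rw [e3]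
        have : 0 ≤ s + 2 := by linarith
        gcongr
      have hW : 0 < w t ^ (s + 1) := by positivity
      have h7 := mul_le_mul_of_nonneg_left (hk t ⟨ht.1.le, ht.2⟩)
        (mul_pos (by positivity : 0 < 2 * p + 1) hX).le
      have h8 := mul_le_mul_of_nonneg_right hlk (mul_pos hX hW).le
      rw [e1, e2]
      linarith
  have h := hm ⟨le_rfl, hr.1.trans_lt hr.2⟩ hr hr.1
  simp only at h
  linarith

/-- The superlinear differential inequality `w' ≥ k w ^ q` with `q = p (s + 2) / (2 p + 1)`; the
constant depends only on the data at `r₀`. -/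
theorem exists_mul_rpow_le_w_deriv {r₀ : ℝ} (hd : 0 ≤ d) (ha : 0 ≤ a) (hb : 0 ≤ b) (hp : 0 < p)
    (hs : 1 ≤ s) (hr₀ : 0 < r₀) (hv₀ : 0 < v r₀) (hw₀ : 0 < w r₀) (hz₀ : 0 < z r₀) :
    ∃ k, 0 < k ∧ ∀ R, RadialProfile d a b p s R u v w z → ∀ r ∈ Ico r₀ R,
      k * w r ^ (p * (s + 2) / (2 * p + 1)) ≤ r ^ a * v r ^ p - d / r * w r := by
  -- Each constant is the smaller of the one allowed by the derivative comparison and the one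
  -- allowed by the starting values. Neither involves `R`, so one constant serves all radii at once.
  obtain ⟨k, hk, hk1, hk2⟩ : ∃ k, 0 < k ∧ k * (s + 1) ≤ (b + 1) / (d + b + 1) * r₀ ^ b ∧
      k * w r₀ ^ (s + 1) ≤ r₀ ^ a * v r₀ ^ p * z r₀ := by
    refine ⟨min ((b + 1) / (d + b + 1) * r₀ ^ b / (s + 1))
      (r₀ ^ a * v r₀ ^ p * z r₀ / w r₀ ^ (s + 1)), by positivity, ?_, ?_⟩
    · rw [← le_div_iff₀ (by positivity)]; exact min_le_left _ _
    · rw [← le_div_iff₀ (by positivity)]; exact min_le_right _ _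
  obtain ⟨l, hl, hl1, hl2⟩ : ∃ l, 0 < l ∧ l * (s + 2) ≤ (2 * p + 1) * k ∧
      l * w r₀ ^ (s + 2) ≤ r₀ ^ (2 * a) * v r₀ ^ (2 * p + 1) := by
    refine ⟨min ((2 * p + 1) * k / (s + 2))
      (r₀ ^ (2 * a) * v r₀ ^ (2 * p + 1) / w r₀ ^ (s + 2)), by positivity, ?_, ?_⟩
    · rw [← le_div_iff₀ (by positivity)]; exact min_le_left _ _
    · rw [← le_div_iff₀ (by positivity)]; exact min_le_right _ _
  have hpos : 0 < 2 * p + 1 := by positivity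
  refine ⟨(a + 1) / (d + a + 1) * (l ^ (p / (2 * p + 1)) * r₀ ^ (a / (2 * p + 1))),
    by positivity, fun R H r hr => ?_⟩
  have hr0 : 0 < r := hr₀.trans_le hr.1
  have hr' : r ∈ Ioo 0 R := ⟨hr0, hr.2⟩
  have hv := H.pos_snd r ⟨hr0.le, hr.2⟩
  have hw := H.w_pos hd r hr'
  have h1 := H.mul_w_rpow_le_snd hd ha hp hs hr₀ hl.le
    (H.mul_w_rpow_le hd ha hb hp hs hr₀ hk1 hk2) hl1 hl2 r hr
  have h2 := Real.rpow_le_rpow (by positivity) h1 (by positivity : 0 ≤ p / (2 * p + 1))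
  rw [Real.mul_rpow hl.le (by positivity), Real.mul_rpow (by positivity) (by positivity),
    ← Real.rpow_mul hw.le, ← Real.rpow_mul hr0.le, ← Real.rpow_mul hv.le,
    mul_div_cancel₀ _ hpos.ne'] at h2
  refine le_trans ?_ (H.le_w_deriv hd ha hp.le r hr')
  -- The power `p / (2p+1)` of the second estimate uses up only part of the weight `r ^ a`; the
  -- leftover factor is bounded below by its value at `r₀`.
  have e1 : r ^ a = r ^ (2 * a * (p / (2 * p + 1))) * r ^ (a / (2 * p + 1)) := by
    rw [← Real.rpow_add hr0]
    congr 1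
    field_simp
  have e2 : p * (s + 2) / (2 * p + 1) = (s + 2) * (p / (2 * p + 1)) := by ring
  rw [e1, e2, mul_assoc]
  refine mul_le_mul_of_nonneg_left ?_ (by positivity)
  have h3 : r₀ ^ (a / (2 * p + 1)) ≤ r ^ (a / (2 * p + 1)) :=
    Real.rpow_le_rpow hr₀.le hr.1 (by positivity)
  calc _ = l ^ (p / (2 * p + 1)) * w r ^ ((s + 2) * (p / (2 * p + 1))) *
        r₀ ^ (a / (2 * p + 1)) := by ring
    _ ≤ (r ^ (2 * a * (p / (2 * p + 1))) * v r ^ p) * r ^ (a / (2 * p + 1)) := by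
        gcongr
    _ = _ := by ring

/-- If `s > 2 (1 + 1 / p)`, the first component is bounded. -/
theorem bounded_fst (hR : 0 < R) (hd : 0 ≤ d) (ha : 0 ≤ a) (hb : 0 ≤ b)
    (hp : 0 < p) (hs : 1 ≤ s) (hps : 2 * (1 + 1 / p) < s)
    (H : RadialProfile d a b p s R u v w z) : ∃ M, ∀ r ∈ Ico 0 R, u r ≤ M := by
  set r₀ := R / 2 with hr₀_def
  have hr₀ : 0 < r₀ := by positivity
  have hr₀R : r₀ < R := by rw [hr₀_def]; linarith
  obtain ⟨k, hk, hkw⟩ := exists_mul_rpow_le_w_deriv (d := d) (a := a) (b := b) (u := u) hd ha hb hp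
    hs hr₀
    (H.pos_snd r₀ ⟨hr₀.le, hr₀R⟩) (H.w_pos hd r₀ ⟨hr₀, hr₀R⟩) (H.z_pos hd r₀ ⟨hr₀, hr₀R⟩)
  set q := p * (s + 2) / (2 * p + 1) with hq
  have hq2 : 0 < q - 2 := by
    have h1 : 2 * p + 2 < p * s := by
      have := mul_lt_mul_of_pos_left hps hp
      field_simp at this
      linarith
    rw [sub_pos, hq, lt_div_iff₀ (by positivity)]
    linarith
  set K := 1 / (k * (q - 2)) with hK
  have hK0 : 0 < K := by positivity
  -- From `w' ≥ k w^q` one gets `u' = w ≤ w' w^(1-q) / k`, the derivative of `-K w^(2-q)`. Since the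
  -- added term is nonnegative, monotonicity bounds `u`.
  have hm : AntitoneOn (fun r => u r + K * w r ^ (2 - q)) (Ico r₀ R) := by
    have hsub : Ico r₀ R ⊆ Ico 0 R := Ico_subset_Ico_left hr₀.le
    refine antitoneOn_Ico_of_hasDerivAt (f' := fun r => w r +
      K * ((r ^ a * v r ^ p - d / r * w r) * (2 - q) * w r ^ (2 - q - 1))) ?_ ?_ ?_
    · refine (H.cont_fst.mono hsub).add (continuousOn_const.mul
        ((H.ode_fst.cont.mono hsub).rpow_const fun t ht => Or.inl ?_))
      exact (H.w_pos hd t ⟨hr₀.trans_le ht.1, ht.2⟩).ne'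
    · intro t ht
      have ht' : t ∈ Ioo 0 R := ⟨hr₀.trans ht.1, ht.2⟩
      exact (H.hasDerivAt_fst t ht').fun_add (((H.ode_fst.hasDerivAt t ht').rpow_const
        (Or.inl (H.w_pos hd t ht').ne')).const_mul K)
    · intro t ht
      have ht' : t ∈ Ioo 0 R := ⟨hr₀.trans ht.1, ht.2⟩
      have hw := H.w_pos hd t ht'
      have h1 := hkw R H t ⟨ht.1.le, ht.2⟩
      have h2 := mul_le_mul_of_nonneg_right h1
        (by positivity : 0 ≤ K * (q - 2) * w t ^ (2 - q - 1))
      have e : k * w t ^ q * (K * (q - 2) * w t ^ (2 - q - 1)) = w t := by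
        have e1 : w t ^ q * w t ^ (2 - q - 1) = w t := by
          rw [← Real.rpow_add hw]; ring_nf; exact Real.rpow_one _
        calc _ = (k * (q - 2)) * K * (w t ^ q * w t ^ (2 - q - 1)) := by ring
          _ = w t := by rw [e1, hK, mul_one_div_cancel (by positivity), one_mul]
      rw [e] at h2
      linarith
  refine ⟨u r₀ + K * w r₀ ^ (2 - q), fun r hr => ?_⟩
  rcases le_total r₀ r with h | h
  · have h1 := hm ⟨le_rfl, hr₀R⟩ ⟨h, hr.2⟩ h
    have hw := H.w_pos hd r ⟨hr₀.trans_le h, hr.2⟩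
    have : 0 ≤ K * w r ^ (2 - q) := by positivity
    simp only at h1
    linarith
  · have h1 := H.monotoneOn_fst hd hr ⟨hr₀.le, hr₀R⟩ h
    have hw := H.w_pos hd r₀ ⟨hr₀, hr₀R⟩
    have : 0 ≤ K * w r₀ ^ (2 - q) := by positivity
    linarith

/-- If `p s > 1`, no profile exists for all radii. -/
theorem not_forall_profile (hd : 0 ≤ d) (ha : 0 ≤ a) (hb : 0 ≤ b)
    (hp : 0 < p) (hs : 1 ≤ s) (hps : 1 < p * s) :
    ¬ ∀ R, 0 < R → RadialProfile d a b p s R u v w z := by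
  intro H
  have h2 : (1 : ℝ) ∈ Ioo 0 2 := by norm_num
  obtain ⟨k, hk, hkw⟩ := exists_mul_rpow_le_w_deriv (d := d) (a := a) (b := b) (u := u) hd ha hb hp
    hs one_pos ((H 2 two_pos).pos_snd 1 (by norm_num)) ((H 2 two_pos).w_pos hd 1 h2)
    ((H 2 two_pos).z_pos hd 1 h2)
  set q := p * (s + 2) / (2 * p + 1) with hq
  have hq1 : 0 < q - 1 := by
    rw [sub_pos, hq, lt_div_iff₀ (by positivity)]
    linarith
  have hw : ∀ r, 0 < r → 0 < w r := fun r hr =>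
    (H (r + 1) (by linarith)).w_pos hd r ⟨hr, by linarith⟩
  have hdw : ∀ r, 0 < r → HasDerivAt w (r ^ a * v r ^ p - d / r * w r) r := fun r hr =>
    (H (r + 1) (by linarith)).ode_fst.hasDerivAt r ⟨hr, by linarith⟩
  -- The positive quantity `w^(1-q)` falls at rate at least `(q-1) k`; starting at radius 1, it
  -- would have to be nonpositive by radius `L`.
  set L := 1 + w 1 ^ (1 - q) / ((q - 1) * k) with hL
  have hw1 := hw 1 one_pos
  have hL1 : 1 < L := by
    have : 0 < w 1 ^ (1 - q) / ((q - 1) * k) := by positivity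
    linarith
  have hder : ∀ r, 0 < r → HasDerivAt (fun r => w r ^ (1 - q) + (q - 1) * k * r)
      ((r ^ a * v r ^ p - d / r * w r) * (1 - q) * w r ^ (1 - q - 1) + (q - 1) * k * 1) r :=
    fun r hr => ((hdw r hr).rpow_const (Or.inl (hw r hr).ne')).fun_add
      ((hasDerivAt_id r).const_mul _)
  have hm : AntitoneOn (fun r => w r ^ (1 - q) + (q - 1) * k * r) (Ico 1 (L + 1)) := by
    refine antitoneOn_Ico_of_hasDerivAt (fun r hr => (hder r
      (one_pos.trans_le hr.1)).continuousAt.continuousWithinAt)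
      (fun r hr => hder r (one_pos.trans hr.1)) ?_
    intro r hr
    have hr0 := one_pos.trans hr.1
    have hwr := hw r hr0
    have h1 := hkw (r + 1) (H _ (by linarith)) r ⟨hr.1.le, by linarith⟩
    have h3 := mul_le_mul_of_nonneg_right h1
      (by positivity : 0 ≤ (q - 1) * w r ^ (1 - q - 1))
    have e1 : w r ^ q * w r ^ (1 - q - 1) = 1 := by
      rw [← Real.rpow_add hwr]; ring_nf; exact Real.rpow_zero _
    have e : k * w r ^ q * ((q - 1) * w r ^ (1 - q - 1)) = (q - 1) * k := by
      calc _ = (q - 1) * k * (w r ^ q * w r ^ (1 - q - 1)) := by ring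
        _ = (q - 1) * k := by rw [e1, mul_one]
    rw [e] at h3
    linarith
  have h := hm ⟨le_rfl, by linarith⟩ ⟨hL1.le, by linarith⟩ hL1.le
  have hwL := hw L (by linarith)
  have h4 : 0 < w L ^ (1 - q) := by positivity
  have h5 : (q - 1) * k * L = (q - 1) * k + w 1 ^ (1 - q) := by
    rw [hL, mul_add, mul_div_cancel₀ _ (by positivity), mul_one]
  simp only at h
  linarith

/-- The reverse comparison comes from two integrations. First, `(w z)' ≥ w' z ≳ v^p v'` gives
`v^(p+1) ≲ w z`. Second, `(w^s v)' ≥ w^s z ≳ z z'` gives `z^2 ≲ w^s v`. Squaring the first,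
inserting the second and cancelling one factor `v` finishes. -/
theorem exists_snd_rpow_le {r₀ : ℝ} (hR : 0 < R) (hd : 0 ≤ d) (ha : 0 ≤ a) (hb : 0 ≤ b)
    (hp : 0 < p) (hs : 1 ≤ s) (hr₀ : r₀ ∈ Ioo 0 R)
    (H : RadialProfile d a b p s R u v w z) :
    ∃ C, 0 < C ∧ ∀ r ∈ Ico r₀ R, v r ^ (2 * p + 1) ≤ C * w r ^ (s + 2) := by
  have hsub : Ico r₀ R ⊆ Ico 0 R := Ico_subset_Ico_left hr₀.1.le
  have hv₀ := H.pos_snd r₀ ⟨hr₀.1.le, hr₀.2⟩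
  have hw₀ := H.w_pos hd r₀ hr₀
  have hz₀ := H.z_pos hd r₀ hr₀
  have hr₀0 := hr₀.1
  obtain ⟨C, hC, hC1, hC2⟩ : ∃ C, 0 < C ∧ p + 1 ≤ C * ((a + 1) / (d + a + 1) * r₀ ^ a) ∧
      v r₀ ^ (p + 1) ≤ C * (w r₀ * z r₀) := by
    refine ⟨max ((p + 1) / ((a + 1) / (d + a + 1) * r₀ ^ a)) (v r₀ ^ (p + 1) / (w r₀ * z r₀)),
      lt_max_of_lt_left (by positivity), ?_, ?_⟩
    · rw [← div_le_iff₀ (by positivity)]; exact le_max_left _ _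
    · rw [← div_le_iff₀ (by positivity)]; exact le_max_right _ _
  obtain ⟨D, hD, hD1, hD2⟩ : ∃ D, 0 < D ∧ 2 * R ^ b ≤ D ∧ z r₀ ^ 2 ≤ D * (w r₀ ^ s * v r₀) := by
    refine ⟨max (2 * R ^ b) (z r₀ ^ 2 / (w r₀ ^ s * v r₀)),
      lt_max_of_lt_left (by positivity), le_max_left _ _, ?_⟩
    rw [← div_le_iff₀ (by positivity)]; exact le_max_right _ _
  have h1 : MonotoneOn (fun r => C * (w r * z r) - v r ^ (p + 1)) (Ico r₀ R) := by
    refine monotoneOn_Ico_of_hasDerivAt (f' := fun r =>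
      C * ((r ^ a * v r ^ p - d / r * w r) * z r + w r * (r ^ b * w r ^ s - d / r * z r))
      - z r * (p + 1) * v r ^ (p + 1 - 1)) ?_ ?_ ?_
    · exact (continuousOn_const.mul ((H.ode_fst.cont.mono hsub).mul
        (H.ode_snd.cont.mono hsub))).sub
        ((H.cont_snd.mono hsub).rpow_const fun _ _ => Or.inr (by positivity))
    · intro t ht
      have ht' : t ∈ Ioo 0 R := ⟨hr₀0.trans ht.1, ht.2⟩
      exact (((H.ode_fst.hasDerivAt t ht').fun_mul (H.z_hasDerivAt hd t ht')).const_mul C).fun_sub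
        ((H.hasDerivAt_snd t ht').rpow_const (Or.inl (H.pos_snd t ⟨ht'.1.le, ht.2⟩).ne'))
    · intro t ht
      have ht' : t ∈ Ioo 0 R := ⟨hr₀0.trans ht.1, ht.2⟩
      have hv := H.pos_snd t ⟨ht'.1.le, ht.2⟩
      have hw := H.w_pos hd t ht'
      have hz := H.z_pos hd t ht'
      have h2 := H.le_w_deriv hd ha hp.le t ht'
      have h3 : 0 ≤ w t * (t ^ b * w t ^ s - d / t * z t) := by
        refine mul_nonneg hw.le
          (le_trans (have := ht'.1; by positivity) (H.le_z_deriv hd ha hb hp.le (by linarith) t ht'))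
      have h4 : r₀ ^ a ≤ t ^ a := Real.rpow_le_rpow hr₀0.le ht.1.le ha
      have h5 : (p + 1) * v t ^ p ≤ C * (t ^ a * v t ^ p - d / t * w t) :=
        calc (p + 1) * v t ^ p ≤ C * ((a + 1) / (d + a + 1) * r₀ ^ a) * v t ^ p := by gcongr
          _ ≤ C * ((a + 1) / (d + a + 1) * t ^ a) * v t ^ p := by gcongr
          _ = C * ((a + 1) / (d + a + 1) * (t ^ a * v t ^ p)) := by ring
          _ ≤ _ := by gcongr
      have h6 := mul_le_mul_of_nonneg_right h5 hz.le
      have h7 := mul_nonneg hC.le h3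
      rw [add_sub_cancel_right]
      linarith
  have h2 : MonotoneOn (fun r => D * (w r ^ s * v r) - z r ^ 2) (Ico r₀ R) := by
    refine monotoneOn_Ico_of_hasDerivAt (f' := fun r =>
      D * ((r ^ a * v r ^ p - d / r * w r) * s * w r ^ (s - 1) * v r + w r ^ s * z r)
      - (2 : ℕ) * z r ^ (2 - 1) * (r ^ b * w r ^ s - d / r * z r)) ?_ ?_ ?_
    · exact (continuousOn_const.mul (((H.ode_fst.cont.mono hsub).rpow_const
        fun _ _ => Or.inr (by linarith)).mul (H.cont_snd.mono hsub))).sub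
        ((H.ode_snd.cont.mono hsub).pow 2)
    · intro t ht
      have ht' : t ∈ Ioo 0 R := ⟨hr₀0.trans ht.1, ht.2⟩
      exact ((((H.ode_fst.hasDerivAt t ht').rpow_const (Or.inr hs)).fun_mul
        (H.hasDerivAt_snd t ht')).const_mul D).fun_sub ((H.z_hasDerivAt hd t ht').fun_pow 2)
    · intro t ht
      have ht' : t ∈ Ioo 0 R := ⟨hr₀0.trans ht.1, ht.2⟩
      have hv := H.pos_snd t ⟨ht'.1.le, ht.2⟩
      have hw := H.w_pos hd t ht'
      have hz := H.z_pos hd t ht'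
      have h3 := H.w_deriv_nonneg hd ha hp.le t ht'
      have h4 := H.z_deriv_le hd t ht'
      have h5 : t ^ b * w t ^ s ≤ R ^ b * w t ^ s := by
        have := Real.rpow_le_rpow ht'.1.le ht.2.le hb
        gcongr
      have h6 : 0 ≤ D * ((t ^ a * v t ^ p - d / t * w t) * s * w t ^ (s - 1) * v t) := by
        positivity
      have h7 := mul_le_mul_of_nonneg_right hD1 (by positivity : 0 ≤ w t ^ s * z t)
      have h8 := mul_le_mul_of_nonneg_left (h4.trans h5) (by positivity : 0 ≤ 2 * z t)
      push_cast
      rw [pow_one]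
      linarith
  refine ⟨C ^ 2 * D, by positivity, fun r hr => ?_⟩
  have hr' : r ∈ Ioo 0 R := ⟨hr₀0.trans_le hr.1, hr.2⟩
  have hv := H.pos_snd r ⟨hr'.1.le, hr.2⟩
  have hw := H.w_pos hd r hr'
  have hz := H.z_pos hd r hr'
  have h3 := h1 ⟨le_rfl, hr₀.2⟩ hr hr.1
  have h4 := h2 ⟨le_rfl, hr₀.2⟩ hr hr.1
  simp only at h3 h4
  have h5 : v r ^ (p + 1) ≤ C * (w r * z r) := by linarith
  have h6 : z r ^ 2 ≤ D * (w r ^ s * v r) := by linarith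
  have h7 : v r ^ (2 * p + 1) * v r ≤ (C ^ 2 * D * w r ^ (s + 2)) * v r :=
    calc v r ^ (2 * p + 1) * v r = (v r ^ (p + 1)) ^ 2 := by
          rw [← Real.rpow_add_one hv.ne', ← Real.rpow_natCast, ← Real.rpow_mul hv.le]
          congr 1
          push_cast
          ring
      _ ≤ (C * (w r * z r)) ^ 2 := by gcongr
      _ = C ^ 2 * w r ^ 2 * z r ^ 2 := by ring
      _ ≤ C ^ 2 * w r ^ 2 * (D * (w r ^ s * v r)) := by gcongr
      _ = _ := by
          rw [Real.rpow_add hw, Real.rpow_two]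
          ring
  exact le_of_mul_le_mul_right h7 hv

/-- If `s ≤ 2 (1 + 1 / p)` and the second component blows up, so does the first. -/
theorem tendsto_fst_atTop (hR : 0 < R) (hd : 0 ≤ d) (ha : 0 ≤ a) (hb : 0 ≤ b)
    (hp : 0 < p) (hs : 1 ≤ s) (hps : s ≤ 2 * (1 + 1 / p))
    (H : RadialProfile d a b p s R u v w z) (hv : Tendsto v (𝓝[<] R) atTop) :
    Tendsto u (𝓝[<] R) atTop := by
  set r₀ := R / 2 with hr₀_def
  have hr₀ : 0 < r₀ := by positivity
  have hr₀R : r₀ < R := by rw [hr₀_def]; linarith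
  have hsub : Ico r₀ R ⊆ Ico 0 R := Ico_subset_Ico_left hr₀.le
  obtain ⟨C, hC, hCv⟩ := H.exists_snd_rpow_le hR hd ha hb hp hs ⟨hr₀, hr₀R⟩
  have hw₀ := H.w_pos hd r₀ ⟨hr₀, hr₀R⟩
  set q := (s + 2) * (p / (2 * p + 1)) with hq
  have hq2 : q ≤ 2 := by
    have h1 : p * s ≤ 2 * p + 2 := by
      have := mul_le_mul_of_nonneg_left hps hp.le
      field_simp at this
      linarith
    rw [hq, ← mul_div_assoc, div_le_iff₀ (by positivity)]
    linarith
  set K := R ^ a * (C ^ (p / (2 * p + 1)) * w r₀ ^ (q - 2)) with hK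
  have hK0 : 0 < K := by positivity
  have hwK : ∀ r ∈ Ico r₀ R, r ^ a * v r ^ p - d / r * w r ≤ K * w r ^ 2 := by
    intro r hr
    have hr' : r ∈ Ioo 0 R := ⟨hr₀.trans_le hr.1, hr.2⟩
    have hr0 := hr'.1
    have hv := H.pos_snd r ⟨hr'.1.le, hr.2⟩
    have hw := H.w_pos hd r hr'
    have h1 := Real.rpow_le_rpow (by positivity) (hCv r hr) (by positivity : 0 ≤ p / (2 * p + 1))
    rw [Real.mul_rpow hC.le (by positivity), ← Real.rpow_mul hw.le, ← Real.rpow_mul hv.le,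
      mul_div_cancel₀ _ (by positivity)] at h1
    -- As `q - 2 ≤ 0` and `w` is nondecreasing, the surplus power is largest at `r₀`.
    have h2 : w r ^ q ≤ w r ^ 2 * w r₀ ^ (q - 2) := by
      have e : w r ^ q = w r ^ 2 * w r ^ (q - 2) := by
        rw [← Real.rpow_two, ← Real.rpow_add hw]; ring_nf
      rw [e]
      refine mul_le_mul_of_nonneg_left ?_ (by positivity)
      exact Real.rpow_le_rpow_of_nonpos hw₀ (H.monotoneOn_w hd ha hp.le
        ⟨hr₀.le, hr₀R⟩ (hsub hr) hr.1) (by linarith)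
    calc _ ≤ r ^ a * v r ^ p := H.w_deriv_le hd r hr'
      _ ≤ R ^ a * (C ^ (p / (2 * p + 1)) * (w r ^ 2 * w r₀ ^ (q - 2))) := by
          refine mul_le_mul (Real.rpow_le_rpow hr0.le hr.2.le ha) (h1.trans ?_)
            (by positivity) (by positivity)
          gcongr
      _ = K * w r ^ 2 := by rw [hK]; ring
  -- Dividing `w' ≤ K w^2` by `w` gives `(log w)' ≤ K u'`, so a bound on `u` would bound `w` and
  -- hence `v`.
  have hm : MonotoneOn (fun r => K * u r - Real.log (w r)) (Ico r₀ R) := by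
    refine monotoneOn_Ico_of_hasDerivAt
      (f' := fun r => K * w r - (r ^ a * v r ^ p - d / r * w r) / w r) ?_ ?_ ?_
    · exact (continuousOn_const.mul (H.cont_fst.mono hsub)).sub
        ((H.ode_fst.cont.mono hsub).log fun t ht =>
          (H.w_pos hd t ⟨hr₀.trans_le ht.1, ht.2⟩).ne')
    · intro t ht
      have ht' : t ∈ Ioo 0 R := ⟨hr₀.trans ht.1, ht.2⟩
      exact ((H.hasDerivAt_fst t ht').const_mul K).fun_sub
        ((H.ode_fst.hasDerivAt t ht').log (H.w_pos hd t ht').ne')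
    · intro t ht
      have hw := H.w_pos hd t ⟨hr₀.trans ht.1, ht.2⟩
      rw [sub_nonneg, div_le_iff₀ hw]
      have := hwK t ⟨ht.1.le, ht.2⟩
      linarith
  have hunb : ∀ A, ∃ r ∈ Ico 0 R, A < u r := by
    by_contra! hcon
    obtain ⟨A, hA⟩ := hcon
    set M := Real.exp (K * A - (K * u r₀ - Real.log (w r₀))) with hM
    have hM0 : 0 < M := Real.exp_pos _
    have hwM₀ : ∀ r ∈ Ico r₀ R, w r ≤ M := by
      intro r hr
      have hw := H.w_pos hd r ⟨hr₀.trans_le hr.1, hr.2⟩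
      have h1 := hm ⟨le_rfl, hr₀R⟩ hr hr.1
      simp only at h1
      have h2 := mul_le_mul_of_nonneg_left (hA r (hsub hr)) hK0.le
      rw [hM, ← Real.log_le_iff_le_exp hw]
      linarith
    have hwM : ∀ r ∈ Ioo 0 R, w r ≤ M := by
      intro r hr
      rcases le_total r₀ r with h | h
      · exact hwM₀ r ⟨h, hr.2⟩
      · exact (H.monotoneOn_w hd ha hp.le ⟨hr.1.le, hr.2⟩ ⟨hr₀.le, hr₀R⟩ h).trans
          (hwM₀ r₀ ⟨le_rfl, hr₀R⟩)
    have hvM := H.bounded_snd_of_bounded_w hR.le hd ha hb hp.le (by linarith) hwM hM0.le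
    obtain ⟨r, h1, h2⟩ := ((hv.eventually_gt_atTop (v 0 + R ^ (b + 1) * M ^ s * R)).and
      (Ioo_mem_nhdsLT hR)).exists
    exact absurd (hvM r ⟨h2.1.le, h2.2⟩) (not_le.2 h1)
  rw [Filter.tendsto_atTop]
  intro A
  obtain ⟨r, hr, hrA⟩ := hunb A
  filter_upwards [Ioo_mem_nhdsLT hr.2] with t ht
  exact hrA.le.trans (H.monotoneOn_fst hd hr ⟨hr.1.trans ht.1.le, ht.2⟩ ht.1.le)

end RadialProfile

end RadialBlowUpRates

/-! ### Existence: least fixed points in `[0, ∞]`, finite blow-up radius, scaling. -/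

section RadialExistence

open Set MeasureTheory
open scoped ENNReal

/-- The `ℝ≥0∞`-valued solution operator `r ↦ r ^ (-d) ∫ t in (0, r], t ^ (d + a) f t` of
`y' + (d / r) y = r ^ a f`, `y 0 = 0`. -/
noncomputable def radialIntegral (d a : ℝ) (f : ℝ → ℝ≥0∞) (r : ℝ) : ℝ≥0∞ :=
  ENNReal.ofReal (r ^ (-d)) * ∫⁻ t in Ioc 0 r, ENNReal.ofReal (t ^ (d + a)) * f t

section RadialIntegral

variable {d a R : ℝ} {f g : ℝ → ℝ≥0∞}

theorem radialIntegral_le_radialIntegral {r : ℝ} (h : ∀ t ∈ Ioc 0 r, f t ≤ g t) :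
    radialIntegral d a f r ≤ radialIntegral d a g r :=
  mul_le_mul_right (setLIntegral_mono' measurableSet_Ioc fun t ht =>
    mul_le_mul_right (h t ht) _) _

theorem radialIntegral_zero : radialIntegral d a f 0 = 0 := by
  simp [radialIntegral]

theorem radialIntegral_zero_zero (r : ℝ) :
    radialIntegral 0 0 f r = ∫⁻ t in Ioc 0 r, f t := by
  simp [radialIntegral]

theorem measurable_radialIntegral : Measurable (radialIntegral d a f) := by
  refine Measurable.mul (by fun_prop) (Monotone.measurable fun x y hxy => ?_)
  exact lintegral_mono_set (Ioc_subset_Ioc_right hxy)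

theorem radialIntegral_le {r : ℝ} {C : ℝ≥0∞} (hd : 0 ≤ d) (ha : 0 ≤ a)
    (h : ∀ t ∈ Ioc 0 r, f t ≤ C) :
    radialIntegral d a f r ≤ ENNReal.ofReal (r ^ (a + 1)) * C := by
  rcases le_or_gt r 0 with hr | hr
  · simp [radialIntegral, Ioc_eq_empty (not_lt.2 hr)]
  calc radialIntegral d a f r
      ≤ ENNReal.ofReal (r ^ (-d)) * ∫⁻ _ in Ioc 0 r, ENNReal.ofReal (r ^ (d + a)) * C :=
        mul_le_mul_right (setLIntegral_mono' measurableSet_Ioc fun t ht =>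
          mul_le_mul' (ENNReal.ofReal_le_ofReal
            (Real.rpow_le_rpow ht.1.le ht.2 (by positivity))) (h t ht)) _
    _ = ENNReal.ofReal (r ^ (-d)) * ENNReal.ofReal (r ^ (d + a)) * ENNReal.ofReal r * C := by
        rw [setLIntegral_const, Real.volume_Ioc, sub_zero]
        ring
    _ = ENNReal.ofReal (r ^ (a + 1)) * C := by
        rw [← ENNReal.ofReal_mul (by positivity), ← ENNReal.ofReal_mul (by positivity)]
        congr 2
        rw [← Real.rpow_add hr, ← Real.rpow_add_one hr.ne']
        congr 1
        ring

/-- Boundedness on every `(0, r]` with `r < R`. -/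
def IsLocallyBoundedBefore (R : ℝ) (f : ℝ → ℝ≥0∞) : Prop :=
  ∀ r ∈ Ico 0 R, ∃ C : ℝ≥0∞, C ≠ ⊤ ∧ ∀ t ∈ Ioc 0 r, f t ≤ C

theorem IsLocallyBoundedBefore.rpow {q : ℝ} (hq : 0 ≤ q) (hf : IsLocallyBoundedBefore R f) :
    IsLocallyBoundedBefore R (fun t => f t ^ q) := fun r hr => by
  obtain ⟨C, hC, h⟩ := hf r hr
  exact ⟨C ^ q, ENNReal.rpow_ne_top_of_nonneg hq hC, fun t ht => ENNReal.rpow_le_rpow (h t ht) hq⟩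

theorem IsLocallyBoundedBefore.radialIntegral (hd : 0 ≤ d) (ha : 0 ≤ a)
    (hf : IsLocallyBoundedBefore R f) : IsLocallyBoundedBefore R (radialIntegral d a f) :=
  fun r hr => by
  obtain ⟨C, hC, h⟩ := hf r hr
  refine ⟨ENNReal.ofReal (r ^ (a + 1)) * C, ENNReal.mul_ne_top ENNReal.ofReal_ne_top hC,
    fun t ht => (radialIntegral_le hd ha fun x hx => h x ⟨hx.1, hx.2.trans ht.2⟩).trans ?_⟩
  gcongr
  · exact ht.1.le
  · exact ht.2

theorem IsLocallyBoundedBefore.intervalIntegrable (hd : 0 ≤ d) (ha : 0 ≤ a)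
    (hm : Measurable f) (hf : IsLocallyBoundedBefore R f) {r : ℝ} (hr : r ∈ Ico 0 R) :
    IntervalIntegrable (fun t => t ^ (d + a) * (f t).toReal) volume 0 r := by
  obtain ⟨C, hC, h⟩ := hf r hr
  rw [intervalIntegrable_iff_integrableOn_Ioc_of_le hr.1]
  refine Measure.integrableOn_of_bounded (M := r ^ (d + a) * C.toReal) (by simp)
    (by fun_prop) ?_
  refine ae_restrict_of_forall_mem measurableSet_Ioc fun t ht => ?_
  rw [Real.norm_of_nonneg (mul_nonneg (Real.rpow_nonneg ht.1.le _) ENNReal.toReal_nonneg)]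
  exact mul_le_mul (Real.rpow_le_rpow ht.1.le ht.2 (by positivity))
    (ENNReal.toReal_mono hC (h t ht)) ENNReal.toReal_nonneg (Real.rpow_nonneg hr.1 _)

theorem radialIntegral_toReal (hm : Measurable f) (hf : IsLocallyBoundedBefore R f) {r : ℝ}
    (hr : r ∈ Ico 0 R) : (radialIntegral d a f r).toReal =
      r ^ (-d) * ∫ t in 0..r, t ^ (d + a) * (f t).toReal := by
  obtain ⟨C, hC, h⟩ := hf r hr
  rw [radialIntegral, ENNReal.toReal_mul, ENNReal.toReal_ofReal (Real.rpow_nonneg hr.1 _),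
    intervalIntegral.integral_of_le hr.1, ← integral_toReal (by fun_prop)]
  · congr 1
    refine setIntegral_congr_fun measurableSet_Ioc fun t ht => ?_
    simp only [ENNReal.toReal_mul, ENNReal.toReal_ofReal (Real.rpow_nonneg ht.1.le _)]
  · refine ae_restrict_of_forall_mem measurableSet_Ioc fun t ht => ?_
    exact ENNReal.mul_lt_top ENNReal.ofReal_lt_top ((h t ht).trans_lt hC.lt_top)

theorem continuousOn_radialIntegral (hd : 0 ≤ d) (ha : 0 ≤ a)
    (hm : Measurable f) (hf : IsLocallyBoundedBefore R f) :
    ContinuousOn (fun r => (radialIntegral d a f r).toReal) (Ico 0 R) := by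
  intro r hr
  rcases hr.1.eq_or_lt with rfl | hr0
  · obtain ⟨C, hC, h⟩ := hf (R / 2) ⟨by linarith [hr.2], by linarith [hr.2]⟩
    have hlim : Tendsto (fun r : ℝ => r ^ (a + 1) * C.toReal) (𝓝[Ico 0 R] 0) (𝓝 0) := by
      have : Continuous fun r : ℝ => r ^ (a + 1) * C.toReal :=
        (Real.continuous_rpow_const (by positivity)).mul continuous_const
      have h2 := this.tendsto 0
      rw [Real.zero_rpow (by positivity), zero_mul] at h2
      exact h2.mono_left nhdsWithin_le_nhds
    rw [ContinuousWithinAt, radialIntegral_zero, ENNReal.toReal_zero]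
    refine tendsto_of_tendsto_of_tendsto_of_le_of_le' tendsto_const_nhds hlim
      (Eventually.of_forall fun _ => ENNReal.toReal_nonneg) ?_
    have hsmall : ∀ᶠ t in 𝓝[Ico 0 R] (0 : ℝ), t < R / 2 :=
      nhdsWithin_le_nhds (Iio_mem_nhds (by linarith [hr.2]))
    filter_upwards [hsmall, self_mem_nhdsWithin] with t ht ht'
    refine ENNReal.toReal_le_of_le_ofReal
      (mul_nonneg (Real.rpow_nonneg ht'.1 _) ENNReal.toReal_nonneg) ?_
    rw [ENNReal.ofReal_mul (Real.rpow_nonneg ht'.1 _), ENNReal.ofReal_toReal hC]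
    exact radialIntegral_le hd ha fun x hx => h x ⟨hx.1, hx.2.trans ht.le⟩
  · have hmid : (r + R) / 2 ∈ Ico 0 R := ⟨by linarith [hr.2], by linarith [hr.2]⟩
    have h1 := intervalIntegral.continuousOn_primitive_interval'
      (IsLocallyBoundedBefore.intervalIntegrable hd ha hm hf hmid) left_mem_uIcc
    rw [uIcc_of_le hmid.1] at h1
    have h2 := (h1 r ⟨hr.1, by linarith [hr.2]⟩).continuousAt
      (Icc_mem_nhds hr0 (by linarith [hr.2]))
    have h3 := (Real.continuousAt_rpow_const r (-d) (Or.inl hr0.ne')).mul h2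
    refine (h3.congr ?_).continuousWithinAt
    filter_upwards [Ioo_mem_nhds hr0 hr.2] with t ht
    exact (radialIntegral_toReal hm hf ⟨ht.1.le, ht.2⟩).symm

theorem radialODE_radialIntegral (hd : 0 ≤ d) (ha : 0 ≤ a)
    (hm : Measurable f) (hf : IsLocallyBoundedBefore R f)
    (hc : ContinuousOn (fun r => (f r).toReal) (Ioo 0 R)) :
    RadialODE d R (fun r => (radialIntegral d a f r).toReal)
      (fun r => r ^ a * (f r).toReal) where
  cont := continuousOn_radialIntegral hd ha hm hf
  zero := by simp [radialIntegral_zero]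
  hasDerivAt := by
    intro r hr
    have hr' : r ∈ Ico 0 R := ⟨hr.1.le, hr.2⟩
    have hF : ContinuousAt (fun t => t ^ (d + a) * (f t).toReal) r :=
      (Real.continuousAt_rpow_const r (d + a) (Or.inl hr.1.ne')).mul
        (hc.continuousAt (Ioo_mem_nhds hr.1 hr.2))
    have hmF : AEStronglyMeasurable (fun t => t ^ (d + a) * (f t).toReal) volume := by fun_prop
    have h1 := intervalIntegral.integral_hasDerivAt_right
      (IsLocallyBoundedBefore.intervalIntegrable hd ha hm hf hr')
      hmF.stronglyMeasurableAtFilter hF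
    have h2 := (Real.hasDerivAt_rpow_const (p := -d) (Or.inl hr.1.ne')).fun_mul h1
    refine (h2.congr_of_eventuallyEq ?_).congr_deriv ?_
    · filter_upwards [Ioo_mem_nhds hr.1 hr.2] with t ht
      exact radialIntegral_toReal hm hf ⟨ht.1.le, ht.2⟩
    · rw [radialIntegral_toReal hm hf hr', Real.rpow_sub_one hr.1.ne', ← mul_assoc,
        ← Real.rpow_add hr.1, neg_add_cancel_left]
      ring

end RadialIntegral

/-- The monotone operator whose fixed points are the second components of radial solutions
with `v 0 = 1`. -/
noncomputable def sndOperator (d a b p s : ℝ) (hp : 0 ≤ p) (hs : 0 ≤ s) :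
    (ℝ → ℝ≥0∞) →o (ℝ → ℝ≥0∞) where
  toFun F r := 1 + radialIntegral 0 0
    (radialIntegral d b fun t => radialIntegral d a (fun x => F x ^ p) t ^ s) r
  monotone' F G hFG r := by
    refine add_le_add_right (radialIntegral_le_radialIntegral fun t _ =>
      radialIntegral_le_radialIntegral fun x _ => ENNReal.rpow_le_rpow
      (radialIntegral_le_radialIntegral fun y _ => ENNReal.rpow_le_rpow (hFG y) hp) hs) 1

section Minimal

variable {d a b p s : ℝ} {hp : 0 ≤ p} {hs : 0 ≤ s}

theorem sndOperator_apply (F : ℝ → ℝ≥0∞) (r : ℝ) : sndOperator d a b p s hp hs F r =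
    1 + ∫⁻ t in Ioc 0 r, radialIntegral d b
      (fun t => radialIntegral d a (fun x => F x ^ p) t ^ s) t := by
  simp [sndOperator, radialIntegral_zero_zero]

theorem lfp_sndOperator_apply (r : ℝ) : OrderHom.lfp (sndOperator d a b p s hp hs) r =
    1 + ∫⁻ t in Ioc 0 r, radialIntegral d b (fun t => radialIntegral d a
      (fun x => OrderHom.lfp (sndOperator d a b p s hp hs) x ^ p) t ^ s) t := by
  rw [← sndOperator_apply (hp := hp) (hs := hs), OrderHom.map_lfp]

/-- The fixed-point equation writes the solution as 1 plus the integral of a nonnegative function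
over `(0, r]`. Monotonicity supplies measurability, and finiteness at `r` bounds it on all of `(0,
r]`. -/
theorem monotone_lfp_sndOperator : Monotone (OrderHom.lfp (sndOperator d a b p s hp hs)) := by
  intro x y hxy
  rw [lfp_sndOperator_apply x, lfp_sndOperator_apply y]
  exact add_le_add_right (lintegral_mono_set (Ioc_subset_Ioc_right hxy)) _

theorem inner_radialIntegral_le {F : ℝ → ℝ≥0∞} {M : ℝ≥0∞} {L t : ℝ} (hd : 0 ≤ d) (ha : 0 ≤ a)
    (hb : 0 ≤ b) (hp : 0 ≤ p) (hs : 0 ≤ s) (htL : t ≤ L) (hF : ∀ x ∈ Ioc 0 t, F x ≤ M) :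
    radialIntegral d b (fun t => radialIntegral d a (fun x => F x ^ p) t ^ s) t ≤
      ENNReal.ofReal (L ^ (b + 1)) * (ENNReal.ofReal (L ^ (a + 1)) * M ^ p) ^ s := by
  rcases le_or_gt t 0 with ht | ht
  · simp [radialIntegral, Ioc_eq_empty (not_lt.2 ht)]
  refine (radialIntegral_le (C := (ENNReal.ofReal (L ^ (a + 1)) * M ^ p) ^ s) hd hb
    fun x hx => ENNReal.rpow_le_rpow ((radialIntegral_le (C := M ^ p) hd ha
      fun y hy => ENNReal.rpow_le_rpow (hF y ⟨hy.1, hy.2.trans hx.2⟩) hp).trans ?_) hs).trans ?_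
  · have := hx.1.le
    have := hx.2.trans htL
    gcongr
  · gcongr

/-- The minimal solution extends past any radius up to which it is bounded. -/
theorem exists_lfp_sndOperator_ne_top {M : ℝ≥0∞} {ρ : ℝ} (hd : 0 ≤ d) (ha : 0 ≤ a)
    (hb : 0 ≤ b) (hρ : 0 ≤ ρ) (hM : M ≠ ⊤)
    (hV : ∀ r ∈ Ico 0 ρ, OrderHom.lfp (sndOperator d a b p s hp hs) r ≤ M) :
    ∃ ε, 0 < ε ∧ OrderHom.lfp (sndOperator d a b p s hp hs) (ρ + ε) ≠ ⊤ := by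
  set V := OrderHom.lfp (sndOperator d a b p s hp hs) with hVdef
  set B : ℝ≥0∞ → ℝ≥0∞ := fun M =>
    ENNReal.ofReal ((ρ + 1) ^ (b + 1)) * (ENNReal.ofReal ((ρ + 1) ^ (a + 1)) * M ^ p) ^ s with hB
  have hBtop : ∀ M, M ≠ ⊤ → B M ≠ ⊤ := fun M hM =>
    ENNReal.mul_ne_top ENNReal.ofReal_ne_top (ENNReal.rpow_ne_top_of_nonneg hs
      (ENNReal.mul_ne_top ENNReal.ofReal_ne_top (ENNReal.rpow_ne_top_of_nonneg hp hM)))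
  -- In the second entry, the first 1 is the initial value, `B M * ρ` bounds the integral over `(0,
  -- ρ)`, and the last 1 is the allowance for `[ρ, ρ + ε]`, within which `ε` is chosen to stay. `B`
  -- uses `ρ + 1` because `ε ≤ 1`.
  set M₂ := max M (1 + B M * ENNReal.ofReal ρ + 1) with hM₂
  have hM₂top : M₂ ≠ ⊤ := by
    refine (max_lt hM.lt_top ?_).ne
    have := ENNReal.mul_lt_top (hBtop M hM).lt_top (ENNReal.ofReal_lt_top (r := ρ))
    exact ENNReal.add_lt_top.2 ⟨ENNReal.add_lt_top.2 ⟨ENNReal.one_lt_top, this⟩,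
      ENNReal.one_lt_top⟩
  obtain ⟨ε, hε0, hε1, hε⟩ : ∃ ε : ℝ, 0 < ε ∧ ε ≤ 1 ∧ B M₂ * ENNReal.ofReal ε ≤ 1 := by
    have h0 : 0 ≤ (B M₂).toReal := ENNReal.toReal_nonneg
    refine ⟨1 / ((B M₂).toReal + 1), by positivity, ?_, ?_⟩
    · rw [div_le_one (by positivity)]; linarith
    · rw [← ENNReal.ofReal_toReal (hBtop _ hM₂top), ← ENNReal.ofReal_mul h0,
        ENNReal.ofReal_le_one, ENNReal.toReal_ofReal h0, mul_one_div, div_le_one (by positivity)]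
      linarith
  -- `F` is a supersolution, and the least fixed point lies below every supersolution. Setting `F =
  -- ⊤` beyond `ρ + ε` makes the inequality trivial there.
  set F : ℝ → ℝ≥0∞ := fun r => if r < ρ then V r else if r ≤ ρ + ε then M₂ else ⊤ with hF
  have hFρ : ∀ r, r < ρ → F r = V r := fun r hr => by simp [hF, hr]
  have hFM : ∀ r, 0 ≤ r → r ≤ ρ + ε → F r ≤ M₂ := fun r h0 hr => by
    rcases lt_or_ge r ρ with h | h
    · rw [hFρ r h]; exact (hV r ⟨h0, h⟩).trans (le_max_left _ _)
    · simp [hF, hr, not_lt.2 h]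
  have hle : V ≤ F := by
    refine OrderHom.lfp_le _ fun r => ?_
    rcases lt_or_ge r ρ with h | h
    · rw [hFρ r h, hVdef, lfp_sndOperator_apply r, sndOperator_apply]
      refine add_le_add_right (setLIntegral_mono' measurableSet_Ioc fun t ht =>
        radialIntegral_le_radialIntegral fun x hx => ENNReal.rpow_le_rpow
        (radialIntegral_le_radialIntegral fun y hy => ?_) hs) 1
      rw [hFρ y (hy.2.trans_lt (hx.2.trans_lt (ht.2.trans_lt h)))]
    · rcases le_or_gt r (ρ + ε) with h' | h'
      · have hFr : F r = M₂ := by simp [hF, h', not_lt.2 h]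
        rw [hFr, sndOperator_apply]
        refine le_trans ?_ (le_max_right _ _)
        have hsub : Ioc 0 r ⊆ Ioo 0 ρ ∪ Icc ρ (ρ + ε) := fun t ht => by
          rcases lt_or_ge t ρ with h1 | h1
          · exact Or.inl ⟨ht.1, h1⟩
          · exact Or.inr ⟨h1, ht.2.trans h'⟩
        rw [add_assoc]
        refine add_le_add_right ((lintegral_mono_set hsub).trans
          ((lintegral_union_le _ _ _).trans (add_le_add ?_ ?_))) 1
        · refine (setLIntegral_mono' (g := fun _ => B M) measurableSet_Ioo fun t ht =>
            inner_radialIntegral_le hd ha hb hp hs (by linarith [ht.2]) fun x hx => ?_).trans ?_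
          · have hxρ := hx.2.trans_lt ht.2
            rw [hFρ x hxρ]
            exact hV x ⟨hx.1.le, hxρ⟩
          · rw [setLIntegral_const, Real.volume_Ioo, sub_zero]
        · refine (setLIntegral_mono' (g := fun _ => B M₂) measurableSet_Icc fun t ht =>
            inner_radialIntegral_le hd ha hb hp hs (by linarith [ht.2]) fun x hx => ?_).trans ?_
          · exact hFM x hx.1.le (hx.2.trans ht.2)
          · rwa [setLIntegral_const, Real.volume_Icc, add_sub_cancel_left]
      · have : F r = ⊤ := by simp [hF, not_le.2 h', not_lt.2 h]
        rw [this]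
        exact le_top
  exact ⟨ε, hε0, ne_top_of_le_ne_top hM₂top
    ((hle (ρ + ε)).trans (hFM _ (by positivity) le_rfl))⟩

/-- The minimal solution gives a radial profile on any interval where it is finite. -/
theorem radialProfile_lfp_sndOperator {R : ℝ} (hd : 0 ≤ d) (ha : 0 ≤ a) (hb : 0 ≤ b)
    {V W Z : ℝ → ℝ≥0∞} (hVdef : V = OrderHom.lfp (sndOperator d a b p s hp hs))
    (hWdef : W = radialIntegral d a fun x => V x ^ p)
    (hZdef : Z = radialIntegral d b fun x => W x ^ s)
    (hV : ∀ r ∈ Ico 0 R, V r ≠ ⊤) :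
    RadialProfile d a b p s R (fun r => 1 + (radialIntegral 0 0 W r).toReal)
      (fun r => (V r).toReal) (fun r => (W r).toReal) (fun r => (Z r).toReal) := by
  have hmono : Monotone V := hVdef ▸ monotone_lfp_sndOperator
  have hVeq : ∀ r, V r = 1 + radialIntegral 0 0 Z r := fun r => by
    rw [radialIntegral_zero_zero, hZdef, hWdef, hVdef]
    exact lfp_sndOperator_apply r
  have hVm : Measurable fun x => V x ^ p := hmono.measurable.pow_const p
  have hVb : IsLocallyBoundedBefore R fun x => V x ^ p :=
    IsLocallyBoundedBefore.rpow hp fun r hr => ⟨V r, hV r hr, fun t ht => hmono ht.2⟩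
  have hWm : Measurable W := hWdef ▸ measurable_radialIntegral
  have hWb : IsLocallyBoundedBefore R W := hWdef ▸ hVb.radialIntegral hd ha
  have hWsm : Measurable fun x => W x ^ s := hWm.pow_const s
  have hZm : Measurable Z := hZdef ▸ measurable_radialIntegral
  have hZb : IsLocallyBoundedBefore R Z := hZdef ▸ (hWb.rpow hs).radialIntegral hd hb
  have hWc : ContinuousOn (fun r => (W r).toReal) (Ico 0 R) := by
    rw [hWdef]; exact continuousOn_radialIntegral hd ha hVm hVb
  have hZc : ContinuousOn (fun r => (Z r).toReal) (Ico 0 R) := by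
    rw [hZdef]; exact continuousOn_radialIntegral hd hb hWsm (hWb.rpow hs)
  have hvode := radialODE_radialIntegral le_rfl le_rfl hZm hZb (hZc.mono Ioo_subset_Ico_self)
  have huode := radialODE_radialIntegral le_rfl le_rfl hWm hWb (hWc.mono Ioo_subset_Ico_self)
  have hveq : ∀ r ∈ Ico 0 R, (V r).toReal = 1 + (radialIntegral 0 0 Z r).toReal := by
    intro r hr
    have h1 := hV r hr
    rw [hVeq] at h1 ⊢
    rw [ENNReal.toReal_add ENNReal.one_ne_top (ENNReal.add_ne_top.1 h1).2, ENNReal.toReal_one]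
  have hVc : ContinuousOn (fun r => (V r).toReal) (Ico 0 R) :=
    (continuousOn_const.add hvode.cont).congr hveq
  refine ⟨continuousOn_const.add huode.cont, hVc,
    fun r _ => add_pos_of_pos_of_nonneg one_pos ENNReal.toReal_nonneg,
    fun r hr => ?_, fun r hr => ?_, fun r hr => ?_, ?_, ?_⟩
  · rw [hveq r hr]
    exact add_pos_of_pos_of_nonneg one_pos ENNReal.toReal_nonneg
  · exact ((huode.hasDerivAt r hr).const_add 1).congr_deriv (by simp)
  · refine (((hvode.hasDerivAt r hr).const_add 1).congr_of_eventuallyEq ?_).congr_deriv (by simp)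
    filter_upwards [Ioo_mem_nhds hr.1 hr.2] with t ht
    exact hveq t ⟨ht.1.le, ht.2⟩
  · have h := radialODE_radialIntegral hd ha hVm hVb (by
      simp only [← ENNReal.toReal_rpow]
      exact (hVc.mono Ioo_subset_Ico_self).rpow_const fun _ _ => Or.inr hp)
    rw [← hWdef] at h
    simpa only [← ENNReal.toReal_rpow] using h
  · have h := radialODE_radialIntegral hd hb hWsm (hWb.rpow hs) (by
      simp only [← ENNReal.toReal_rpow]
      exact (hWc.mono Ioo_subset_Ico_self).rpow_const fun _ _ => Or.inr hs)
    rw [← hZdef] at h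
    simpa only [← ENNReal.toReal_rpow, abs_of_nonneg ENNReal.toReal_nonneg] using h

end Minimal

/-- If `p s > 1`, some profile has its second component blowing up at a finite radius. -/
theorem exists_radialProfile_tendsto_atTop_of_radius {d a b p s : ℝ} (hd : 0 ≤ d) (ha : 0 ≤ a)
    (hb : 0 ≤ b) (hp : 0 < p) (hs : 1 ≤ s) (hps : 1 < p * s) :
    ∃ (ρ : ℝ) (u v w z : ℝ → ℝ), 0 < ρ ∧ RadialProfile d a b p s ρ u v w z ∧
      Tendsto v (𝓝[<] ρ) atTop := by
  have hs0 : 0 ≤ s := by linarith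
  set V := OrderHom.lfp (sndOperator d a b p s hp.le hs0) with hVdef
  have hmono : Monotone V := monotone_lfp_sndOperator
  -- The infimum of `S` is the blow-up radius. `S` is nonempty, since otherwise the minimal solution
  -- would give a profile on every interval.
  set S : Set ℝ := {r | 0 ≤ r ∧ V r = ⊤} with hS
  have hprof : ∀ R, (∀ r ∈ Ico 0 R, V r ≠ ⊤) → _ := fun R hR =>
    radialProfile_lfp_sndOperator (R := R) hd ha hb hVdef rfl rfl hR
  have hSne : S.Nonempty := by
    by_contra hcon
    refine RadialProfile.not_forall_profile hd ha hb hp hs hps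
      fun R _ => hprof R fun r hr hr' => hcon ⟨r, hr.1, hr'⟩
  have hSbdd : BddBelow S := ⟨0, fun r hr => hr.1⟩
  set ρ := sInf S with hρdef
  have hlt : ∀ r, 0 ≤ r → r < ρ → V r ≠ ⊤ := fun r h0 hr hr' =>
    absurd (csInf_le hSbdd ⟨h0, hr'⟩) (not_le.2 hr)
  have hgt : ∀ r, ρ < r → V r = ⊤ := fun r hr => by
    obtain ⟨t, ht, htr⟩ := exists_lt_of_csInf_lt hSne hr
    exact top_le_iff.1 (ht.2 ▸ hmono htr.le)
  have hρ : 0 < ρ := by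
    -- With `ρ = 0` the boundedness assumption is vacuous, so this is local existence from the
    -- origin.
    obtain ⟨ε, hε, h⟩ := exists_lfp_sndOperator_ne_top (M := 0) (ρ := 0) (hp := hp.le) (hs := hs0)
      hd ha hb le_rfl ENNReal.zero_ne_top (fun r hr => absurd hr.2 (not_lt.2 hr.1))
    by_contra hcon
    exact h (hgt _ (by linarith))
  refine ⟨ρ, _, _, _, _, hρ, hprof ρ fun r hr => hlt r hr.1 hr.2, ?_⟩
  -- A bound before `ρ` would let the solution stay finite slightly past `ρ`, where it is infinite.
  -- Monotonicity then turns unboundedness into divergence.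
  have hunb : ∀ A : ℝ, ∃ r ∈ Ico 0 ρ, A < (V r).toReal := by
    by_contra! hcon
    obtain ⟨A, hA⟩ := hcon
    obtain ⟨ε, hε, h⟩ := exists_lfp_sndOperator_ne_top (M := ENNReal.ofReal A) (ρ := ρ)
      (hp := hp.le) (hs := hs0) hd ha hb hρ.le ENNReal.ofReal_ne_top (fun r hr =>
        (ENNReal.le_ofReal_iff_toReal_le (hlt r hr.1 hr.2)
          (ENNReal.toReal_nonneg.trans (hA r hr))).2 (hA r hr))
    exact h (hgt _ (by linarith))
  rw [Filter.tendsto_atTop]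
  intro A
  obtain ⟨r, hr, hrA⟩ := hunb A
  filter_upwards [Ioo_mem_nhdsLT hr.2] with t ht
  exact hrA.le.trans (ENNReal.toReal_mono (hlt t (hr.1.trans ht.1.le) ht.2) (hmono ht.1.le))

theorem RadialODE.congr_right {d R : ℝ} {f h h' : ℝ → ℝ} (H : RadialODE d R f h)
    (hh : ∀ r ∈ Ioo 0 R, h r = h' r) : RadialODE d R f h' :=
  ⟨H.cont, H.zero, fun r hr => hh r hr ▸ H.hasDerivAt r hr⟩

theorem mem_Ico_of_scale {R l r : ℝ} (hl : 0 < l) (hr : r ∈ Ico 0 R) :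
    l * r ∈ Ico 0 (l * R) :=
  ⟨mul_nonneg hl.le hr.1, mul_lt_mul_of_pos_left hr.2 hl⟩

theorem mem_Ioo_of_scale {R l r : ℝ} (hl : 0 < l) (hr : r ∈ Ioo 0 R) :
    l * r ∈ Ioo 0 (l * R) :=
  ⟨mul_pos hl hr.1, mul_lt_mul_of_pos_left hr.2 hl⟩

theorem ContinuousOn.scale {R l c : ℝ} {f : ℝ → ℝ} (hl : 0 < l)
    (hf : ContinuousOn f (Ico 0 (l * R))) : ContinuousOn (fun r => c * f (l * r)) (Ico 0 R) :=
  continuousOn_const.mul (hf.comp (by fun_prop) fun _ hr => mem_Ico_of_scale hl hr)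

theorem HasDerivAt.scale {l c r f' : ℝ} {f : ℝ → ℝ} (hf : HasDerivAt f f' (l * r)) :
    HasDerivAt (fun r => c * f (l * r)) (c * l * f') r := by
  have h := (HasDerivAt.comp r hf ((hasDerivAt_id r).const_mul l)).const_mul c
  exact h.congr_deriv (by ring)

theorem RadialODE.scale {d R l : ℝ} (c : ℝ) {f h : ℝ → ℝ} (hl : 0 < l)
    (H : RadialODE d (l * R) f h) :
    RadialODE d R (fun r => c * f (l * r)) (fun r => c * l * h (l * r)) where
  cont := H.cont.scale hl
  zero := by simp [H.zero]
  hasDerivAt r hr := by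
    refine (H.hasDerivAt _ (mem_Ioo_of_scale hl hr)).scale.congr_deriv ?_
    have := hr.1.ne'
    field_simp

/-- Scaling `v` by `l^A` and `w` by `l^B` preserves the equations when `B + 1 + a = p A` and `A + 2
+ b = s B`. This linear system is solvable because `p s ≠ 1`. -/
theorem RadialProfile.scale {d a b p s R l : ℝ} {u v w z : ℝ → ℝ} (hps : 1 < p * s) (hl : 0 < l)
    (H : RadialProfile d a b p s (l * R) u v w z) :
    ∃ u' w' z', RadialProfile d a b p s R u'
      (fun r => l ^ ((2 + b + (1 + a) * s) / (p * s - 1)) * v (l * r)) w' z' := by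
  set A := (2 + b + (1 + a) * s) / (p * s - 1) with hA
  have hA' : A * (p * s - 1) = 2 + b + (1 + a) * s := div_mul_cancel₀ _ (by linarith)
  set B := A * p - 1 - a with hB
  have hlA : 0 < l ^ A := Real.rpow_pos_of_pos hl _
  have hlB : 0 < l ^ B := Real.rpow_pos_of_pos hl _
  refine ⟨fun r => l ^ (B - 1) * u (l * r), fun r => l ^ B * w (l * r),
    fun r => l ^ A * l * z (l * r), H.cont_fst.scale hl, H.cont_snd.scale hl,
    fun r hr => mul_pos (Real.rpow_pos_of_pos hl _) (H.pos_fst _ (mem_Ico_of_scale hl hr)),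
    fun r hr => mul_pos hlA (H.pos_snd _ (mem_Ico_of_scale hl hr)),
    fun r hr => ?_, fun r hr => (H.hasDerivAt_snd _ (mem_Ioo_of_scale hl hr)).scale,
    (H.ode_fst.scale (l ^ B) hl).congr_right fun r hr => ?_,
    (H.ode_snd.scale (l ^ A * l) hl).congr_right fun r hr => ?_⟩
  · refine (H.hasDerivAt_fst _ (mem_Ioo_of_scale hl hr)).scale.congr_deriv ?_
    rw [← Real.rpow_add_one hl.ne', sub_add_cancel]
  · have hv := H.pos_snd _ (mem_Ico_of_scale hl ⟨hr.1.le, hr.2⟩)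
    have e : l ^ B * l * l ^ a = (l ^ A) ^ p := by
      rw [← Real.rpow_add_one hl.ne', ← Real.rpow_add hl, ← Real.rpow_mul hl.le]
      congr 1
      rw [hB]; ring
    rw [Real.mul_rpow hl.le hr.1.le, Real.mul_rpow hlA.le hv.le, ← e]
    ring
  · have e : l ^ A * l * l * l ^ b = (l ^ B) ^ s := by
      rw [← Real.rpow_add_one hl.ne', ← Real.rpow_add_one hl.ne', ← Real.rpow_add hl,
        ← Real.rpow_mul hl.le]
      congr 1
      rw [hB]; linear_combination -hA'
    rw [abs_mul, abs_of_pos hlB, Real.mul_rpow hl.le hr.1.le,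
      Real.mul_rpow hlB.le (abs_nonneg _), ← e]
    ring

/-- If `p s > 1`, for every radius some profile has its second component blowing up there. -/
theorem exists_radialProfile_tendsto_atTop {d a b p s R : ℝ} (hR : 0 < R) (hd : 0 ≤ d)
    (ha : 0 ≤ a) (hb : 0 ≤ b) (hp : 0 < p) (hs : 1 ≤ s) (hps : 1 < p * s) :
    ∃ u v w z : ℝ → ℝ, RadialProfile d a b p s R u v w z ∧ Tendsto v (𝓝[<] R) atTop := by
  obtain ⟨ρ, u, v, w, z, hρ, H, hv⟩ :=
    exists_radialProfile_tendsto_atTop_of_radius hd ha hb hp hs hps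
  have hl : 0 < ρ / R := by positivity
  have hlR : ρ / R * R = ρ := div_mul_cancel₀ _ hR.ne'
  rw [← hlR] at H
  obtain ⟨u', w', z', H'⟩ := H.scale hps hl
  refine ⟨u', _, w', z', H', Tendsto.const_mul_atTop (Real.rpow_pos_of_pos hl _) (hv.comp ?_)⟩
  refine tendsto_nhdsWithin_iff.2 ⟨?_, ?_⟩
  · have h : Tendsto (fun r => ρ / R * r) (𝓝 R) (𝓝 (ρ / R * R)) :=
      (continuous_const_mul _).tendsto _
    rw [hlR] at h
    exact h.mono_left nhdsWithin_le_nhds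
  · filter_upwards [self_mem_nhdsWithin] with r hr
    have h := mul_lt_mul_of_pos_left (mem_Iio.1 hr) hl
    rwa [hlR] at h

end RadialExistence

/-! ### Radial functions on Euclidean space: gradient, Hessian, Laplacian, regularity at the origin.
-/

section RadialGeometry

open Set

/-- L'Hôpital applied to `r^d f / r^(d+1)`, where the integrating factor makes the quotient of
derivatives `h / (d + 1)`. The limit is the missing value of `f / r` at the origin, needed for `C²`
regularity there. -/
theorem RadialODE.tendsto_div {d R : ℝ} {f h : ℝ → ℝ} (hR : 0 < R) (hd : 0 ≤ d)
    (H : RadialODE d R f h) (hh : ContinuousOn h (Ico 0 R)) :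
    Tendsto (fun r => f r / r) (𝓝[>] 0) (𝓝 (h 0 / (d + 1))) := by
  have key : Tendsto (fun r => (r ^ d * f r) / r ^ (d + 1)) (𝓝[>] 0) (𝓝 (h 0 / (d + 1))) := by
    refine HasDerivAt.lhopital_zero_right_on_Ico (f' := fun r => r ^ d * h r)
      (g' := fun r => (d + 1) * r ^ d) hR
      (fun r hr => H.hasDerivAt_rpow_mul hr) (fun r hr => ?_) (H.continuousOn_rpow_mul hd)
      (Real.continuous_rpow_const (by positivity)).continuousOn (fun r hr => ?_) (by simp [H.zero])
      (Real.zero_rpow (by positivity)) ?_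
    · simpa using Real.hasDerivAt_rpow_const (p := d + 1) (Or.inl hr.1.ne')
    · have := hr.1
      positivity
    · have h1 : Tendsto h (𝓝[>] 0) (𝓝 (h 0)) := by
        rw [← nhdsWithin_Ioo_eq_nhdsGT hR]
        exact ((hh 0 ⟨le_rfl, hR⟩).mono Ioo_subset_Ico_self).tendsto
      refine (h1.div_const (d + 1)).congr' ?_
      filter_upwards [self_mem_nhdsWithin] with r hr
      have := Real.rpow_pos_of_pos (mem_Ioi.1 hr) d
      field_simp
  refine key.congr' ?_
  filter_upwards [self_mem_nhdsWithin] with r hr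
  rw [Real.rpow_add_one (mem_Ioi.1 hr).ne', mul_div_mul_left _ _
    (Real.rpow_pos_of_pos (mem_Ioi.1 hr) d).ne']

/-- The quotient `f r / r`, with its limiting value `c` at the origin. -/
noncomputable def radialQuotient (c : ℝ) (f : ℝ → ℝ) (r : ℝ) : ℝ :=
  if r = 0 then c else f r / r

theorem RadialODE.continuousOn_radialQuotient {d R : ℝ} {f h : ℝ → ℝ} (hR : 0 < R) (hd : 0 ≤ d)
    (H : RadialODE d R f h) (hh : ContinuousOn h (Ico 0 R)) :
    ContinuousOn (radialQuotient (h 0 / (d + 1)) f) (Ico 0 R) := by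
  intro r hr
  rcases hr.1.eq_or_lt with rfl | hr0
  · have h1 : Tendsto (radialQuotient (h 0 / (d + 1)) f) (𝓝[>] 0) (𝓝 (h 0 / (d + 1))) := by
      refine (H.tendsto_div hR hd hh).congr' ?_
      filter_upwards [self_mem_nhdsWithin] with r hr
      simp [radialQuotient, (mem_Ioi.1 hr).ne']
    have h2 : ContinuousWithinAt (radialQuotient (h 0 / (d + 1)) f) (Ioi 0) 0 := by
      simpa [ContinuousWithinAt, radialQuotient] using h1
    exact (continuousWithinAt_Ioi_iff_Ici.1 h2).mono Ico_subset_Ici_self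
  · refine ContinuousAt.continuousWithinAt (ContinuousAt.congr (f := fun r => f r / r) ?_ ?_)
    · exact ((H.cont.continuousAt (Ico_mem_nhds hr0 hr.2))).div continuousAt_id hr0.ne'
    · filter_upwards [Ioi_mem_nhds hr0] with t ht
      simp [radialQuotient, (mem_Ioi.1 ht).ne']

variable {E : Type*} [NormedAddCommGroup E] [InnerProductSpace ℝ E]

/-- The real inner product as a continuous bilinear map. -/
noncomputable def realInnerCLM (E : Type*) [NormedAddCommGroup E] [InnerProductSpace ℝ E] :
    E →L[ℝ] E →L[ℝ] ℝ :=
  (isBoundedBilinearMap_inner (𝕜 := ℝ) (E := E)).toContinuousLinearMap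

theorem realInnerCLM_apply (x y : E) : realInnerCLM E x y = inner ℝ x y := rfl

theorem norm_realInnerCLM_apply (x : E) : ‖realInnerCLM E x‖ = ‖x‖ := by
  have : realInnerCLM E x = innerSL ℝ x := by ext y; rfl
  rw [this, innerSL_apply_norm]

theorem hasFDerivAt_norm_of_ne_zero {x : E} (hx : x ≠ 0) :
    HasFDerivAt (fun y : E => ‖y‖) (‖x‖⁻¹ • realInnerCLM E x) x := by
  have h1 := ((hasFDerivAt_id x).norm_sq).sqrt (pow_pos (norm_pos_iff.2 hx) 2).ne'
  have h2 : (fun y : E => ‖y‖) = fun y : E => √(‖id y‖ ^ 2) := by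
    ext y
    rw [id, Real.sqrt_sq (norm_nonneg _)]
  rw [h2]
  refine h1.congr_fderiv ?_
  ext y
  have : ‖x‖ ≠ 0 := norm_ne_zero_iff.2 hx
  simp [Real.sqrt_sq (norm_nonneg _), realInnerCLM_apply]
  field_simp

theorem HasDerivAt.comp_norm {φ : ℝ → ℝ} {c : ℝ} {x : E} (hx : x ≠ 0)
    (h : HasDerivAt φ c ‖x‖) :
    HasFDerivAt (fun y => φ ‖y‖) ((c / ‖x‖) • realInnerCLM E x) x := by
  refine (h.comp_hasFDerivAt x (hasFDerivAt_norm_of_ne_zero hx)).congr_fderiv ?_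
  rw [smul_smul, div_eq_mul_inv]

/-- The derivative of the radial vector field `x ↦ g x`, where `q = r g'`. -/
noncomputable def radialHessian (g q : ℝ) (x : E) : E →L[ℝ] E :=
  g • ContinuousLinearMap.id ℝ E + q • (((‖x‖ ^ 2)⁻¹ • realInnerCLM E x).smulRight x)

theorem hasFDerivAt_comp_norm_smul {G : ℝ → ℝ} {q : ℝ} {x : E} (hx : x ≠ 0)
    (h : HasDerivAt G (q / ‖x‖) ‖x‖) :
    HasFDerivAt (fun y : E => G ‖y‖ • y) (radialHessian (G ‖x‖) q x) x := by
  refine ((h.comp_norm hx).fun_smul (hasFDerivAt_id x)).congr_fderiv ?_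
  ext y
  simp only [radialHessian, id, add_apply, smul_apply, ContinuousLinearMap.smulRight_apply,
    smul_eq_mul, smul_smul]
  congr 2
  field_simp

/-- The Laplacian is the trace of `radialHessian`: the identity part gives the dimension times `g`,
and the rank-one part gives `q` by Parseval. At the origin the rank-one part vanishes, which is why
`q = 0` is required there. -/
theorem laplacian_eq_of_fderiv_eq [FiniteDimensional ℝ E] {u : E → ℝ} {X : E → E}
    {g q : ℝ} {x : E} (hu : fderiv ℝ u =ᶠ[𝓝 x] fun y => realInnerCLM E (X y))
    (h : HasFDerivAt X (radialHessian g q x) x) (hq : x = 0 → q = 0) :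
    Δ u x = Module.finrank ℝ E * g + q := by
  have h2 : HasFDerivAt (fderiv ℝ u) ((realInnerCLM E).comp (radialHessian g q x)) x :=
    ((realInnerCLM E).hasFDerivAt.comp x h).congr_of_eventuallyEq hu
  rw [InnerProductSpace.laplacian_eq_iteratedFDeriv_orthonormalBasis u (stdOrthonormalBasis ℝ E)]
  simp only [iteratedFDeriv_two_apply, h2.fderiv, Matrix.cons_val_zero, Matrix.cons_val_one]
  simp only [radialHessian, ContinuousLinearMap.comp_apply, add_apply, smul_apply,
    ContinuousLinearMap.smulRight_apply, ContinuousLinearMap.id_apply, realInnerCLM_apply,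
    inner_add_left, inner_smul_left, RCLike.conj_to_real,
    smul_eq_mul, Finset.sum_add_distrib, ← Finset.mul_sum, mul_assoc, ← sq]
  rw [(stdOrthonormalBasis ℝ E).sum_sq_inner_left]
  have h1 : ∀ i, inner ℝ (stdOrthonormalBasis ℝ E i) (stdOrthonormalBasis ℝ E i) = (1 : ℝ) := by
    intro i
    rw [real_inner_self_eq_norm_sq, (stdOrthonormalBasis ℝ E).norm_eq_one, one_pow]
  simp only [h1, Finset.sum_const, Finset.card_univ, Fintype.card_fin, nsmul_eq_mul, mul_one]
  rcases eq_or_ne x 0 with rfl | hx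
  · rw [hq rfl]; ring
  · rw [inv_mul_cancel₀ (pow_ne_zero 2 (norm_ne_zero_iff.2 hx))]; ring

theorem norm_gradient_eq_of_hasFDerivAt [CompleteSpace E] {u : E → ℝ} {g : ℝ} {x : E}
    (h : HasFDerivAt u (g • realInnerCLM E x) x) : ‖∇ u x‖ = |g| * ‖x‖ := by
  rw [← (InnerProductSpace.toDual ℝ E).norm_map, toDual_gradient, h.fderiv, norm_smul,
    norm_realInnerCLM_apply, Real.norm_eq_abs]

/-- The rank-one factor has norm at most 1 although its direction has no limit at the origin;
continuity of the Hessian there thus reduces to scalar limits of `g` and `q`. -/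
theorem norm_radialHessian_sub_le (g g' q : ℝ) (x : E) :
    ‖radialHessian g q x - g' • ContinuousLinearMap.id ℝ E‖ ≤ |g - g'| + |q| := by
  refine ContinuousLinearMap.opNorm_le_bound _ (by positivity) fun y => ?_
  have h1 : (radialHessian g q x - g' • ContinuousLinearMap.id ℝ E) y = (g - g') • y +
      (q * ((‖x‖ ^ 2)⁻¹ * inner ℝ x y)) • x := by
    simp [radialHessian, realInnerCLM_apply, sub_smul, smul_smul]
    abel
  have h2 : |inner ℝ x y| ≤ ‖x‖ * ‖y‖ := abs_real_inner_le_norm x y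
  rw [h1]
  refine (norm_add_le _ _).trans ?_
  rw [norm_smul, norm_smul, Real.norm_eq_abs, Real.norm_eq_abs, abs_mul, abs_mul,
    abs_of_nonneg (by positivity : 0 ≤ (‖x‖ ^ 2)⁻¹), add_mul]
  refine add_le_add_right ?_ _
  calc |q| * ((‖x‖ ^ 2)⁻¹ * |inner ℝ x y|) * ‖x‖
      ≤ |q| * ((‖x‖ ^ 2)⁻¹ * (‖x‖ * ‖y‖)) * ‖x‖ := by gcongr
    _ = |q| * ‖y‖ * ((‖x‖ ^ 2)⁻¹ * ‖x‖ ^ 2) := by ring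
    _ ≤ |q| * ‖y‖ * 1 := by gcongr; exact inv_mul_le_one
    _ = |q| * ‖y‖ := mul_one _

/-- A radial function built from a solution of the radial equation is `C²`, with the expected
gradient norm and Laplacian. -/
theorem RadialODE.contDiffOn_comp_norm [FiniteDimensional ℝ E] {d R : ℝ} {φ f h : ℝ → ℝ}
    (hR : 0 < R) (hd : 0 ≤ d) (hdim : (Module.finrank ℝ E : ℝ) = d + 1)
    (hφ : ContinuousOn φ (Ico 0 R)) (hφ' : ∀ r ∈ Ioo 0 R, HasDerivAt φ (f r) r)
    (H : RadialODE d R f h) (hh : ContinuousOn h (Ico 0 R)) :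
    ContDiffOn ℝ 2 (fun x : E => φ ‖x‖) (ball 0 R) ∧ ∀ x ∈ ball (0 : E) R,
      Δ (fun x : E => φ ‖x‖) x = h ‖x‖ ∧ ‖∇ (fun x : E => φ ‖x‖) x‖ = |f ‖x‖| := by
  set G := radialQuotient (h 0 / (d + 1)) f with hG
  have hG0 : G 0 = h 0 / (d + 1) := by simp [hG, radialQuotient]
  have hGr : ∀ r, r ≠ 0 → G r = f r / r := fun r hr => by simp [hG, radialQuotient, hr]
  have hGc : ContinuousOn G (Ico 0 R) := H.continuousOn_radialQuotient hR hd hh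
  -- This is `r G' = f' - f / r` rewritten through the equation, a form that is continuous up to `r
  -- = 0` and vanishes there.
  set q : ℝ → ℝ := fun r => h r - (d + 1) * G r with hq
  have hq0 : q 0 = 0 := by
    simp only [hq, hG0]
    field_simp
    ring
  have hqc : ContinuousOn q (Ico 0 R) := hh.sub (continuousOn_const.mul hGc)
  have hball : ∀ x ∈ ball (0 : E) R, ‖x‖ ∈ Ico 0 R := fun x hx =>
    ⟨norm_nonneg _, mem_ball_zero_iff.1 hx⟩
  have hballo : ∀ x ∈ ball (0 : E) R, x ≠ 0 → ‖x‖ ∈ Ioo 0 R := fun x hx h0 =>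
    ⟨norm_pos_iff.2 h0, mem_ball_zero_iff.1 hx⟩
  have htend : Tendsto (fun y : E => ‖y‖) (𝓝 0) (𝓝[Ico 0 R] 0) := by
    refine tendsto_nhdsWithin_iff.2 ⟨by simpa using continuous_norm.tendsto (0 : E), ?_⟩
    filter_upwards [ball_mem_nhds (0 : E) hR] with y hy using hball y hy
  have hmem0 : (0 : ℝ) ∈ Ico 0 R := ⟨le_rfl, hR⟩
  have hG0lim : Tendsto (fun y : E => G ‖y‖) (𝓝 0) (𝓝 (G 0)) := (hGc 0 hmem0).tendsto.comp htend
  have hq0lim : Tendsto (fun y : E => q ‖y‖) (𝓝 0) (𝓝 0) := by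
    have := (hqc 0 hmem0).tendsto.comp htend
    rwa [hq0] at this
  have h1 : ∀ x ∈ ball (0 : E) R,
      HasFDerivAt (fun x : E => φ ‖x‖) (G ‖x‖ • realInnerCLM E x) x := by
    intro x hx
    rcases eq_or_ne x 0 with rfl | hx0
    · have hder : HasDerivWithinAt φ 0 (Ici 0) 0 := by
        refine hasDerivWithinAt_Ici_of_tendsto_deriv (s := Ioo 0 R) (fun r hr =>
          (hφ' r hr).differentiableAt.differentiableWithinAt)
          ((hφ 0 hmem0).mono Ioo_subset_Ico_self) (Ioo_mem_nhdsGT hR) ?_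
        have hf0 : Tendsto f (𝓝[>] 0) (𝓝 0) := by
          rw [← nhdsWithin_Ioo_eq_nhdsGT hR]
          simpa [ContinuousWithinAt, H.zero] using
            (H.cont 0 hmem0).mono Ioo_subset_Ico_self
        refine hf0.congr' ?_
        filter_upwards [Ioo_mem_nhdsGT hR] with r hr
        exact (hφ' r hr).deriv.symm
      rw [map_zero, smul_zero]
      have h2 := (hasDerivWithinAt_iff_isLittleO.1 hder)
      have hn : Tendsto (fun y : E => ‖y‖) (𝓝 0) (𝓝[Ici 0] 0) :=
        tendsto_nhdsWithin_iff.2 ⟨by simpa using continuous_norm.tendsto (0 : E),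
          Eventually.of_forall fun y => norm_nonneg y⟩
      have h3 := h2.comp_tendsto hn
      refine HasFDerivAt.of_isLittleO ?_
      simp only [smul_zero, sub_zero, Function.comp_def] at h3
      simpa using h3.of_norm_right
    · rw [hGr _ (norm_ne_zero_iff.2 hx0)]
      exact (hφ' _ (hballo x hx hx0)).comp_norm hx0
  have h2 : ∀ x ∈ ball (0 : E) R, HasFDerivAt (fun x : E => G ‖x‖ • x)
      (radialHessian (G ‖x‖) (q ‖x‖) x) x := by
    intro x hx
    rcases eq_or_ne x 0 with rfl | hx0
    · rw [norm_zero, hq0]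
      refine HasFDerivAt.of_isLittleO ?_
      have h3 : (fun y : E => (G ‖y‖ - G 0) • y) =o[𝓝 0] fun y => y := by
        have e1 : (fun y : E => G ‖y‖ - G 0) =o[𝓝 0] fun _ => (1 : ℝ) := by
          rw [Asymptotics.isLittleO_one_iff]
          simpa using hG0lim.sub_const (G 0)
        simpa using e1.smul_isBigO (Asymptotics.isBigO_refl (fun y : E => y) (𝓝 0))
      refine (h3.congr_left fun y => ?_).congr_right fun y => (sub_zero y).symm
      simp [radialHessian, sub_smul]
    · have hr := hballo x hx hx0
      refine hasFDerivAt_comp_norm_smul hx0 ?_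
      have h3 := (H.hasDerivAt _ hr).fun_div (hasDerivAt_id _) hr.1.ne'
      refine (h3.congr_of_eventuallyEq ?_).congr_deriv ?_
      · filter_upwards [Ioi_mem_nhds hr.1] with t ht
        exact hGr t (mem_Ioi.1 ht).ne'
      · simp only [hq, hGr _ hr.1.ne', id]
        have := hr.1.ne'
        field_simp
        ring
  have hfd : ∀ x ∈ ball (0 : E) R,
      fderiv ℝ (fun x : E => φ ‖x‖) x = realInnerCLM E (G ‖x‖ • x) := fun x hx => by
    rw [(h1 x hx).fderiv, map_smul]
  have hcont : ContinuousOn (fun x : E => radialHessian (G ‖x‖) (q ‖x‖) x) (ball 0 R) := by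
    intro x hx
    refine ContinuousAt.continuousWithinAt ?_
    rcases eq_or_ne x 0 with rfl | hx0
    · have hz : radialHessian (G ‖(0 : E)‖) (q ‖(0 : E)‖) (0 : E) =
          G 0 • ContinuousLinearMap.id ℝ E := by simp [radialHessian]
      rw [ContinuousAt, hz]
      refine tendsto_iff_norm_sub_tendsto_zero.2 (squeeze_zero (fun _ => norm_nonneg _)
        (fun y => norm_radialHessian_sub_le (G ‖y‖) (G 0) (q ‖y‖) y) ?_)
      have e := (hG0lim.sub_const (G 0)).abs.add hq0lim.abs
      simpa using e
    · have hr := hballo x hx hx0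
      have hn : Ico 0 R ∈ 𝓝 ‖x‖ := Ico_mem_nhds hr.1 hr.2
      have e1 : ContinuousAt (fun y : E => G ‖y‖) x :=
        ContinuousAt.comp (g := G) (hGc.continuousAt hn) continuous_norm.continuousAt
      have e2 : ContinuousAt (fun y : E => q ‖y‖) x :=
        ContinuousAt.comp (g := q) (hqc.continuousAt hn) continuous_norm.continuousAt
      have e3 : ContinuousAt (fun y : E => (‖y‖ ^ 2)⁻¹) x :=
        (continuous_norm.pow 2).continuousAt.inv₀ (pow_ne_zero 2 hr.1.ne')
      have e4 : ContinuousAt (fun y : E => realInnerCLM E y) x :=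
        (realInnerCLM E).continuous.continuousAt
      have e5 : ContinuousAt (fun y : E =>
          ((‖y‖ ^ 2)⁻¹ • realInnerCLM E y).smulRight y) x := by
        have := (ContinuousLinearMap.smulRightL ℝ E E).continuous.continuousAt.comp
          (e3.smul e4)
        exact this.clm_apply continuousAt_id
      exact (e1.smul continuousAt_const).add (e2.smul e5)
  refine ⟨?_, fun x hx => ⟨?_, ?_⟩⟩
  · rw [show (2 : WithTop ℕ∞) = 1 + 1 by norm_num, contDiffOn_succ_iff_fderiv_of_isOpen isOpen_ball]
    refine ⟨fun x hx => (h1 x hx).differentiableAt.differentiableWithinAt, by simp, ?_⟩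
    have hX : ContDiffOn ℝ (0 + 1) (fun x : E => G ‖x‖ • x) (ball 0 R) := by
      rw [contDiffOn_succ_iff_fderiv_of_isOpen isOpen_ball]
      refine ⟨fun x hx => (h2 x hx).differentiableAt.differentiableWithinAt, by simp, ?_⟩
      rw [contDiffOn_zero]
      exact hcont.congr fun x hx => (h2 x hx).fderiv
    rw [zero_add] at hX
    exact ((realInnerCLM E).contDiff.comp_contDiffOn hX).congr hfd
  · have hev : fderiv ℝ (fun x : E => φ ‖x‖) =ᶠ[𝓝 x] fun y => realInnerCLM E (G ‖y‖ • y) := by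
      filter_upwards [isOpen_ball.mem_nhds hx] with y hy
      exact hfd y hy
    rw [laplacian_eq_of_fderiv_eq hev (h2 x hx) (by rintro rfl; rwa [norm_zero]), hdim]
    simp only [hq]
    ring
  · rw [norm_gradient_eq_of_hasFDerivAt (h1 x hx)]
    rcases eq_or_ne x 0 with rfl | hx0
    · simp [H.zero]
    · rw [hGr _ (norm_ne_zero_iff.2 hx0), abs_div, abs_norm,
        div_mul_cancel₀ _ (norm_ne_zero_iff.2 hx0)]

/-- The restriction of a radial `C²` function to a ray, and its differential operators. -/
theorem exists_radial_deriv [FiniteDimensional ℝ E] {R : ℝ} {u : E → ℝ} {e : E} (he : ‖e‖ = 1)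
    (hR : 0 < R)
    (hu : ContDiffOn ℝ 2 u (ball 0 R))
    (hrad : ∀ x ∈ ball (0 : E) R, ∀ y ∈ ball (0 : E) R, ‖x‖ = ‖y‖ → u x = u y) :
    ∃ w w' : ℝ → ℝ, ContinuousOn (fun r => u (r • e)) (Ico 0 R) ∧ ContinuousOn w (Ico 0 R) ∧
      w 0 = 0 ∧ ∀ r ∈ Ioo 0 R, HasDerivAt (fun r => u (r • e)) (w r) r ∧ HasDerivAt w (w' r) r ∧
        Δ u (r • e) = w' r + (Module.finrank ℝ E - 1) / r * w r ∧ ‖∇ u (r • e)‖ = |w r| := by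
  set U : ℝ → ℝ := fun r => u (r • e) with hU
  have hnorm : ∀ r : ℝ, ‖r • e‖ = |r| := fun r => by
    rw [norm_smul, he, mul_one, Real.norm_eq_abs]
  have hmaps : ∀ r ∈ Ioo (-R) R, r • e ∈ ball (0 : E) R := fun r hr => by
    rw [mem_ball_zero_iff, hnorm]
    exact abs_lt.2 hr
  have hUC : ContDiffOn ℝ 2 U (Ioo (-R) R) :=
    hu.comp (by fun_prop : ContDiff ℝ 2 fun r : ℝ => r • e).contDiffOn hmaps
  rw [show (2 : WithTop ℕ∞) = 1 + 1 by norm_num,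
    contDiffOn_succ_iff_deriv_of_isOpen isOpen_Ioo] at hUC
  obtain ⟨hUd, -, hU1⟩ := hUC
  have hsub : Ico 0 R ⊆ Ioo (-R) R := fun r hr => ⟨by linarith [hr.1], hr.2⟩
  have hUder : ∀ r ∈ Ioo (-R) R, HasDerivAt U (deriv U r) r := fun r hr =>
    ((hUd r hr).differentiableAt (isOpen_Ioo.mem_nhds hr)).hasDerivAt
  have hwder : ∀ r ∈ Ioo (-R) R, HasDerivAt (deriv U) (deriv (deriv U) r) r := fun r hr =>
    ((hU1.differentiableOn (by norm_num) r hr).differentiableAt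
      (isOpen_Ioo.mem_nhds hr)).hasDerivAt
  refine ⟨deriv U, deriv (deriv U), hUd.continuousOn.mono hsub,
    hU1.continuousOn.mono hsub, ?_, fun r hr => ?_⟩
  · have h0 : (0 : ℝ) ∈ Ioo (-R) R := ⟨by linarith, hR⟩
    have h1 := hUder 0 h0
    have h2 : HasDerivAt (fun r => U (-r)) (-deriv U 0) 0 := by
      have h3 : HasDerivAt U (deriv U 0) (-0) := by simpa using h1
      simpa [Function.comp_def] using h3.comp (0 : ℝ) (hasDerivAt_neg 0)
    -- Radial symmetry makes the restriction to the line even, so its derivative at 0 vanishes.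
    have h4 : (fun r => U (-r)) =ᶠ[𝓝 0] U := by
      filter_upwards [isOpen_Ioo.mem_nhds h0] with r hr
      exact hrad _ (hmaps _ ⟨by linarith [hr.2], by linarith [hr.1]⟩) _ (hmaps r hr)
        (by rw [hnorm, hnorm, abs_neg])
    have := (h2.congr_of_eventuallyEq h4.symm).unique h1
    linarith
  · have hr' := hsub ⟨hr.1.le, hr.2⟩
    set x := r • e with hx
    have hxr : ‖x‖ = r := by rw [hx, hnorm, abs_of_pos hr.1]
    have hx0 : x ≠ 0 := norm_ne_zero_iff.1 (by rw [hxr]; exact hr.1.ne')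
    have hxb : x ∈ ball (0 : E) R := hmaps r hr'
    have hopen : {y : E | y ≠ 0} ∩ ball 0 R ∈ 𝓝 x :=
      inter_mem (isOpen_ne.mem_nhds hx0) (isOpen_ball.mem_nhds hxb)
    have huU : ∀ y ∈ ball (0 : E) R, u y = U ‖y‖ := fun y hy => by
      have hy' := mem_ball_zero_iff.1 hy
      refine hrad _ hy _ (hmaps _ ⟨by linarith [norm_nonneg y], hy'⟩) ?_
      rw [hnorm, abs_norm]
    have h1 : ∀ y ∈ {y : E | y ≠ 0} ∩ ball 0 R,
        HasFDerivAt u ((deriv U ‖y‖ / ‖y‖) • realInnerCLM E y) y := fun y hy => by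
      have hy' := mem_ball_zero_iff.1 hy.2
      refine ((hUder ‖y‖ ⟨by linarith [norm_nonneg y], hy'⟩).comp_norm hy.1).congr_of_eventuallyEq
        ?_
      filter_upwards [isOpen_ball.mem_nhds hy.2] with t ht using huU t ht
    have h2 : HasFDerivAt (fun y : E => (deriv U ‖y‖ / ‖y‖) • y) (radialHessian
        (deriv U ‖x‖ / ‖x‖) (deriv (deriv U) r - deriv U r / r) x) x := by
      refine hasFDerivAt_comp_norm_smul (G := fun r => deriv U r / r) hx0 ?_
      rw [hxr]
      refine ((hwder r hr').fun_div (hasDerivAt_id r) hr.1.ne').congr_deriv ?_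
      have := hr.1.ne'
      simp only [id]
      field_simp
    have h3 : fderiv ℝ u =ᶠ[𝓝 x] fun y => realInnerCLM E ((deriv U ‖y‖ / ‖y‖) • y) := by
      filter_upwards [hopen] with y hy
      rw [(h1 y hy).fderiv, map_smul]
    refine ⟨hUder r hr', hwder r hr', ?_, ?_⟩
    · rw [laplacian_eq_of_fderiv_eq h3 h2 (fun h => absurd h hx0), hxr]
      ring
    · rw [norm_gradient_eq_of_hasFDerivAt (h1 x ⟨hx0, hxb⟩), hxr, abs_div, abs_of_pos hr.1,
        div_mul_cancel₀ _ hr.1.ne']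

end RadialGeometry

/-! ### Translation between profiles and solutions on the ball, then the theorem. -/

section RadialSolutions

open Set

variable {N : ℕ} {R a b p s : ℝ}

theorem RadialProfile.isPositiveRadialSolution (hN : 1 ≤ N) (hR : 0 < R) (ha : 0 ≤ a) (hb : 0 ≤ b)
    (hp : 0 ≤ p) (hs : 0 ≤ s) {u v w z : ℝ → ℝ}
    (H : RadialProfile ((N : ℝ) - 1) a b p s R u v w z) :
    IsPositiveRadialSolution (N := N) R a b p s (fun x => u ‖x‖) (fun x => v ‖x‖) := by
  have hd : (0 : ℝ) ≤ (N : ℝ) - 1 := by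
    have : (1 : ℝ) ≤ N := by exact_mod_cast hN
    linarith
  have hdim : (Module.finrank ℝ (EuclideanSpace ℝ (Fin N)) : ℝ) = ((N : ℝ) - 1) + 1 := by
    rw [finrank_euclideanSpace_fin]; ring
  have hmem : ∀ x ∈ ball (0 : EuclideanSpace ℝ (Fin N)) R, ‖x‖ ∈ Ico 0 R := fun x hx =>
    ⟨norm_nonneg _, mem_ball_zero_iff.1 hx⟩
  obtain ⟨hu1, hu2⟩ := H.ode_fst.contDiffOn_comp_norm (E := EuclideanSpace ℝ (Fin N)) hR hd hdim
    H.cont_fst H.hasDerivAt_fst ((Real.continuous_rpow_const ha).continuousOn.mul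
      (H.cont_snd.rpow_const fun _ _ => Or.inr hp))
  obtain ⟨hv1, hv2⟩ := H.ode_snd.contDiffOn_comp_norm (E := EuclideanSpace ℝ (Fin N)) hR hd hdim
    H.cont_snd H.hasDerivAt_snd ((Real.continuous_rpow_const hb).continuousOn.mul
      (H.ode_fst.cont.abs.rpow_const fun _ _ => Or.inr hs))
  exact
    { contDiffOn_fst := hu1
      contDiffOn_snd := hv1
      radial_fst := fun x _ y _ hxy => congrArg u hxy
      radial_snd := fun x _ y _ hxy => congrArg v hxy
      pos_fst := fun x hx => H.pos_fst _ (hmem x hx)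
      pos_snd := fun x hx => H.pos_snd _ (hmem x hx)
      eq_fst := fun x hx => (hu2 x hx).1
      eq_snd := fun x hx => by rw [(hv2 x hx).1, (hu2 x hx).2] }

theorem IsPositiveRadialSolution.exists_radialProfile {u v : EuclideanSpace ℝ (Fin N) → ℝ}
    (hR : 0 < R) (H : IsPositiveRadialSolution R a b p s u v)
    {e : EuclideanSpace ℝ (Fin N)} (he : ‖e‖ = 1) :
    ∃ w z : ℝ → ℝ, RadialProfile ((N : ℝ) - 1) a b p s R (fun r => u (r • e))
      (fun r => v (r • e)) w z := by
  obtain ⟨w, w', hu, hw, hw0, hw1⟩ := exists_radial_deriv he hR H.contDiffOn_fst H.radial_fst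
  obtain ⟨z, z', hv, hz, hz0, hz1⟩ := exists_radial_deriv he hR H.contDiffOn_snd H.radial_snd
  have hnorm : ∀ r : ℝ, 0 ≤ r → ‖r • e‖ = r := fun r hr => by
    rw [norm_smul, he, mul_one, Real.norm_of_nonneg hr]
  have hmem : ∀ r ∈ Ico 0 R, r • e ∈ ball (0 : EuclideanSpace ℝ (Fin N)) R := fun r hr => by
    rw [mem_ball_zero_iff, hnorm r hr.1]
    exact hr.2
  refine ⟨w, z, hu, hv, fun r hr => H.pos_fst _ (hmem r hr), fun r hr => H.pos_snd _ (hmem r hr),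
    fun r hr => (hw1 r hr).1, fun r hr => (hz1 r hr).1, ⟨hw, hw0, fun r hr => ?_⟩,
    ⟨hz, hz0, fun r hr => ?_⟩⟩
  · obtain ⟨-, h2, h3, -⟩ := hw1 r hr
    rw [H.eq_fst _ (hmem r ⟨hr.1.le, hr.2⟩), hnorm r hr.1.le, finrank_euclideanSpace_fin] at h3
    exact h2.congr_deriv (by linarith)
  · obtain ⟨-, h2, h3, -⟩ := hz1 r hr
    obtain ⟨-, -, -, h4⟩ := hw1 r hr
    rw [H.eq_snd _ (hmem r ⟨hr.1.le, hr.2⟩), hnorm r hr.1.le, finrank_euclideanSpace_fin, h4] at h3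
    exact h2.congr_deriv (by linarith)

theorem isBoundedOnBall_iff {u : EuclideanSpace ℝ (Fin N) → ℝ} (hrad : IsRadialOnBall R u)
    (hpos : ∀ x ∈ ball (0 : EuclideanSpace ℝ (Fin N)) R, 0 < u x)
    {e : EuclideanSpace ℝ (Fin N)} (he : ‖e‖ = 1) :
    IsBoundedOnBall R u ↔ ∃ M, ∀ r ∈ Ico 0 R, u (r • e) ≤ M := by
  have hnorm : ∀ r : ℝ, 0 ≤ r → ‖r • e‖ = r := fun r hr => by
    rw [norm_smul, he, mul_one, Real.norm_of_nonneg hr]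
  refine ⟨fun ⟨M, hM⟩ => ⟨M, fun r hr => (le_abs_self _).trans (hM _ ?_)⟩,
    fun ⟨M, hM⟩ => ⟨M, fun x hx => ?_⟩⟩
  · rw [mem_ball_zero_iff, hnorm r hr.1]
    exact hr.2
  · have hx' := mem_ball_zero_iff.1 hx
    rw [abs_of_pos (hpos x hx), hrad x hx (‖x‖ • e) _ (hnorm _ (norm_nonneg x)).symm]
    · exact hM _ ⟨norm_nonneg x, hx'⟩
    · rwa [mem_ball_zero_iff, hnorm _ (norm_nonneg x)]

theorem BlowsUpAtBoundary.tendsto_smul {u : EuclideanSpace ℝ (Fin N) → ℝ} (hR : 0 < R)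
    (hu : BlowsUpAtBoundary R u) {e : EuclideanSpace ℝ (Fin N)} (he : ‖e‖ = 1) :
    Tendsto (fun r : ℝ => u (r • e)) (𝓝[<] R) atTop := by
  refine hu.comp (tendsto_comap_iff.2 (tendsto_id.congr' ?_))
  filter_upwards [Ioo_mem_nhdsLT hR] with r hr
  simp [norm_smul, he, abs_of_pos hr.1]

theorem blowsUpAtBoundary_comp_norm {φ : ℝ → ℝ} (h : Tendsto φ (𝓝[<] R) atTop) :
    BlowsUpAtBoundary R (fun x : EuclideanSpace ℝ (Fin N) => φ ‖x‖) :=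
  h.comp tendsto_comap

theorem not_bounded_of_tendsto_atTop {φ : ℝ → ℝ} (hR : 0 < R) (h : Tendsto φ (𝓝[<] R) atTop) :
    ¬ ∃ M, ∀ r ∈ Ico 0 R, φ r ≤ M := by
  rintro ⟨M, hM⟩
  obtain ⟨r, h1, h2⟩ := ((h.eventually_gt_atTop M).and (Ioo_mem_nhdsLT hR)).exists
  exact absurd (hM r ⟨h2.1.le, h2.2⟩) (not_le.2 h1)

end RadialSolutions

theorem mainTheorem3 (N : ℕ) (hN : 1 ≤ N) (R a b p s : ℝ) (hR : 0 < R)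
    (ha : 0 ≤ a) (hb : 0 ≤ b) (hp : 0 < p) (hs : 1 ≤ s) :
    ((∀ u v : EuclideanSpace ℝ (Fin N) → ℝ, IsPositiveRadialSolution R a b p s u v →
        IsBoundedOnBall R u ∧ IsBoundedOnBall R v) ↔ p * s ≤ 1) ∧
    ((∃ u v : EuclideanSpace ℝ (Fin N) → ℝ, IsPositiveRadialSolution R a b p s u v ∧
        IsBoundedOnBall R u ∧ BlowsUpAtBoundary R v) ↔ 2 * (1 + 1 / p) < s) ∧
    ((∃ u v : EuclideanSpace ℝ (Fin N) → ℝ, IsPositiveRadialSolution R a b p s u v ∧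
        BlowsUpAtBoundary R u ∧ BlowsUpAtBoundary R v) ↔
      1 / p < s ∧ s ≤ 2 * (1 + 1 / p)) ∧
    ((∃ u v : EuclideanSpace ℝ (Fin N) → ℝ, IsPositiveRadialSolution R a b p s u v ∧
        BlowsUpAtBoundary R u) ↔ 1 / p < s ∧ s ≤ 2 * (1 + 1 / p)) := by
  have hs0 : 0 ≤ s := by linarith
  have hd : (0 : ℝ) ≤ (N : ℝ) - 1 := by
    have : (1 : ℝ) ≤ N := by exact_mod_cast hN
    linarith
  obtain ⟨e, he⟩ : ∃ e : EuclideanSpace ℝ (Fin N), ‖e‖ = 1 :=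
    ⟨EuclideanSpace.single ⟨0, hN⟩ 1, by simp⟩
  have hinv : 1 / p < s ↔ 1 < p * s := by rw [div_lt_iff₀ hp, mul_comm]
  have hbdd : ∀ u v : EuclideanSpace ℝ (Fin N) → ℝ, IsPositiveRadialSolution R a b p s u v →
      p * s ≤ 1 → IsBoundedOnBall R u ∧ IsBoundedOnBall R v := by
    intro u v H hps
    obtain ⟨w, z, hprof⟩ := H.exists_radialProfile hR he
    obtain ⟨M, hM⟩ := hprof.bounded_of_mul_le_one hR hd ha hb hp.le hs0 hps
    exact ⟨(isBoundedOnBall_iff H.radial_fst H.pos_fst he).2 ⟨M, fun r hr => (hM r hr).1⟩,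
      (isBoundedOnBall_iff H.radial_snd H.pos_snd he).2 ⟨M, fun r hr => (hM r hr).2⟩⟩
  have hnot : ∀ u : EuclideanSpace ℝ (Fin N) → ℝ, IsRadialOnBall R u →
      (∀ x ∈ ball (0 : EuclideanSpace ℝ (Fin N)) R, 0 < u x) →
      BlowsUpAtBoundary R u → ¬ IsBoundedOnBall R u := fun u h1 h2 h3 h4 =>
    not_bounded_of_tendsto_atTop hR (h3.tendsto_smul hR he) ((isBoundedOnBall_iff h1 h2 he).1 h4)
  -- A single solution with `v` blowing up at `R` settles all the existence claims, because the size
  -- of `s` forces the behaviour of `u`.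
  have hex : 1 < p * s → ∃ u v : EuclideanSpace ℝ (Fin N) → ℝ,
      IsPositiveRadialSolution R a b p s u v ∧ BlowsUpAtBoundary R v ∧
      (2 * (1 + 1 / p) < s → IsBoundedOnBall R u) ∧
      (s ≤ 2 * (1 + 1 / p) → BlowsUpAtBoundary R u) := by
    intro hps
    obtain ⟨u, v, w, z, hprof, hv⟩ :=
      exists_radialProfile_tendsto_atTop hR hd ha hb hp hs hps
    have H := hprof.isPositiveRadialSolution hN hR ha hb hp.le hs0
    refine ⟨_, _, H, blowsUpAtBoundary_comp_norm hv, fun h => ?_, fun h => ?_⟩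
    · refine (isBoundedOnBall_iff H.radial_fst H.pos_fst he).2 ?_
      obtain ⟨M, hM⟩ := hprof.bounded_fst hR hd ha hb hp hs h
      refine ⟨M, fun r hr => ?_⟩
      rw [norm_smul, he, mul_one, Real.norm_of_nonneg hr.1]
      exact hM r hr
    · exact blowsUpAtBoundary_comp_norm (hprof.tendsto_fst_atTop hR hd ha hb hp hs h hv)
  have hnec : ∀ u v : EuclideanSpace ℝ (Fin N) → ℝ, IsPositiveRadialSolution R a b p s u v →
      BlowsUpAtBoundary R u → 1 / p < s ∧ s ≤ 2 * (1 + 1 / p) := by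
    intro u v H hu
    have hub := hnot u H.radial_fst H.pos_fst hu
    refine ⟨hinv.2 (not_le.1 fun h => hub (hbdd u v H h).1), not_lt.1 fun h => hub ?_⟩
    obtain ⟨w, z, hprof⟩ := H.exists_radialProfile hR he
    exact (isBoundedOnBall_iff H.radial_fst H.pos_fst he).2
      (hprof.bounded_fst hR hd ha hb hp hs h)
  refine ⟨⟨fun h => ?_, fun h u v H => hbdd u v H h⟩, ⟨?_, fun h => ?_⟩, ⟨?_, fun h => ?_⟩,
    ⟨?_, fun h => ?_⟩⟩
  · by_contra hcon
    obtain ⟨u, v, H, hv, -⟩ := hex (not_le.1 hcon)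
    exact hnot v H.radial_snd H.pos_snd hv (h u v H).2
  · rintro ⟨u, v, H, hu, hv⟩
    by_contra hcon
    obtain ⟨w, z, hprof⟩ := H.exists_radialProfile hR he
    exact not_bounded_of_tendsto_atTop hR (hprof.tendsto_fst_atTop hR hd ha hb hp hs
      (not_lt.1 hcon) (hv.tendsto_smul hR he))
      ((isBoundedOnBall_iff H.radial_fst H.pos_fst he).1 hu)
  · have h1 : 1 / p < s := by
      have : 0 < 1 / p := by positivity
      linarith
    obtain ⟨u, v, H, hv, hu, -⟩ := hex (hinv.1 h1)
    exact ⟨u, v, H, hu h, hv⟩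
  · rintro ⟨u, v, H, hu, -⟩
    exact hnec u v H hu
  · obtain ⟨u, v, H, hv, -, hu⟩ := hex (hinv.1 h.1)
    exact ⟨u, v, H, hu h.2, hv⟩
  · rintro ⟨u, v, H, hu⟩
    exact hnec u v H hu
  · obtain ⟨u, v, H, -, -, hu⟩ := hex (hinv.1 h.1)
    exact ⟨u, v, H, hu h.2⟩
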